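/- **Conventions.** For a nonempty set $X\subset\mathbb R^n$ whose affine hull $A=\mathrm{aff}(X)$ is rational, choose $w\in A$, put $A_0=A-w$ and $r=\dim A$. The lattice volume $\mathrm{Vol}(X)$ is the measure of $X-w$ under the Lebesgue measure on $A_0$, scaled such that $\mathrm{conv}(0,b_1,\dots,b_r)$ has measure $1$ for a $\mathbb Z$-basis $b_1,\dots,b_r$ of $A_0\cap\mathbb Z^n$; this does not depend on the choices. For a nonempty rational affine subspace $H\subset\mathbb R^n$ and a point $x$, the lattice height $\mathrm{Ht}_H(x)$ is $0$ if $x\in H$. Otherwise let $A=\mathrm{aff}(x,H)$ and choose $w\in A$. Then $H-w$ is cut out from $A-w$ by an equation $\mu(y)=\beta$, where $\mu$ is a linear form that restricts to a primitive $\mathbb Z$-linear form on $(A-w)\cap\mathbb Z^n$ (it is integral there and takes the value $1$), and $\mathrm{Ht}_H(x)=|\mu(x-w)-\beta|$. For a polytope $F$ put $\mathrm{Ht}_F=\mathrm{Ht}_{\mathrm{aff}(F)}$. The dimension of a set is the dimension of its affine hull. $\mathbb Z$-linear forms on $\mathbb Z^n$ are extended linearly to $\mathbb R^n$. **Proposition.**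 Let $v_1,\dots,v_m\in\mathbb Z^n$ and let $C=\mathbb R_+v_1+\dots+\mathbb R_+v_m$ be the cone generated by $v_1,\dots,v_m$. Let $\delta$ be a primitive $\mathbb Z$-linear form on $\mathbb Z^n$ (that is, $\delta(y)=1$ for some $y\in\mathbb Z^n$) with $\delta(x)>0$ for all nonzero $x\in C$. Set $P=\{x\in C:\delta(x)=1\}$ and suppose that $d=\dim P\ge 1$. For $X\subset\mathbb R^n$ write $\overline X=\mathrm{conv}(\{0\}\cup X)$. 1. The polytope $P$ has only finitely many facets, and for every $v\in C$, $v\ne 0$, one has $$\mathrm{Vol}(\overline P)=\frac1{\delta(v)}\sum_{F\text{ facet of }P}\mathrm{Ht}_{\overline F}(v)\,\mathrm{Vol}(\overline F).$$ 2. Let $F$ be a facet of $P$, and suppose that $\overline F$ is cut out from $\overline P$ by a $\mathbb Z$-linear form $\lambda$ on $\mathbb Z^n$ with $\lambda(x)\ge 0$ for $x\in\overline P$, that is, $\overline F=\{x\in\overline P:\lambda(x)=0\}$. Let $u_1,\dots,u_{d+1}$ be a $\mathbb Z$-basis of $\mathrm{aff}(\overline P)\cap\mathbb Z^n$ and set $g=\gcd(\lambda(u_1),\dots,\lambda(u_{d+1}))$.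 Then $\mathrm{Ht}_{\overline F}(v)=\lambda(v)/g$ for every $v\in C$. 3. Suppose that $m=d+1$ and that $v_1,\dots,v_m$ are linearly independent, and let $u_1,\dots,u_{d+1}$ be a $\mathbb Z$-basis of $\mathrm{aff}(\overline P)\cap\mathbb Z^n$. Then there is a unique integral $m\times m$ matrix $T=(t_{ij})$ with $v_i=\sum_{j=1}^m t_{ij}u_j$ for $i=1,\dots,m$, and $$\mathrm{Vol}(\overline P)=\frac{1}{\delta(v_1)\cdots\delta(v_m)}\,|\det(T)|.$$ -/

import Mathlib

open MeasureTheory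

noncomputable section

namespace LatticeVolume

variable {n : ℕ}

/-- The inclusion `ℤⁿ → ℝⁿ`. -/
def intCast (n : ℕ) : (Fin n → ℤ) →ₗ[ℤ] (Fin n → ℝ) :=
  (Int.castAddHom ℝ).toIntLinearMap.compLeft (Fin n)

/-- The `ℝ`-linear extension to `ℝⁿ` of a `ℤ`-linear form on `ℤⁿ`. -/
def realForm (φ : (Fin n → ℤ) →ₗ[ℤ] ℤ) : (Fin n → ℝ) →ₗ[ℝ] ℝ :=
  (Pi.basisFun ℝ (Fin n)).constr ℝ fun i => (φ (Pi.single i 1) : ℝ)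

/-- The lattice `W ∩ ℤⁿ` of a linear subspace `W` of `ℝⁿ`, as a subgroup of `ℤⁿ`. -/
def lattice (W : Submodule ℝ (Fin n → ℝ)) : Submodule ℤ (Fin n → ℤ) :=
  (W.restrictScalars ℤ).comap (intCast n)

/-- The dimension of a subset of `ℝⁿ`, i.e. the dimension of its affine hull. -/
def dim (X : Set (Fin n → ℝ)) : ℕ :=
  Module.finrank ℝ (affineSpan ℝ X).direction

/-- The simplex `conv(0, b₁, …, b_r)` spanned by `0` and a `ℤ`-basis of `W ∩ ℤⁿ`,
as a subset of `W`. -/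
def unimodularSimplex (W : Submodule ℝ (Fin n → ℝ)) : Set W :=
  {y : W | (y : Fin n → ℝ) ∈ convexHull ℝ (insert 0 (Set.range fun i =>
    intCast n (Module.finBasis ℤ (lattice W) i)))}

/-- The lattice normalized volume of `X`: translate `X` by a point `w` of its affine hull `A`
into the linear space `W = A - w`, and there take the Lebesgue measure, scaled in such a way that
the simplex spanned by `0` and a `ℤ`-basis of `W ∩ ℤⁿ` has measure `1`. (The Haar measure
`Measure.addHaar` on `W` is Lebesgue measure up to a positive factor, which cancels.)
The empty set has volume `0`. -/
def vol (X : Set (Fin n → ℝ)) : ℝ :=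
  open Classical in
  if h : X.Nonempty then
    (Measure.addHaar : Measure (affineSpan ℝ X).direction).real
        {y | h.some + (y : Fin n → ℝ) ∈ X} /
      (Measure.addHaar : Measure (affineSpan ℝ X).direction).real
        (unimodularSimplex (affineSpan ℝ X).direction)
  else 0

/-- `ℓ`, restricted to `W`, is (the real extension of) a primitive `ℤ`-linear form on `W ∩ ℤⁿ`:
it takes integral values there, and the value `1`. -/
def IsPrimitiveOn (ℓ : (Fin n → ℝ) →ₗ[ℝ] ℝ) (W : Submodule ℝ (Fin n → ℝ)) : Prop :=
  (∀ z ∈ lattice W, ∃ k : ℤ, ℓ (intCast n z) = k) ∧ ∃ z ∈ lattice W, ℓ (intCast n z) = 1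

/-- `h = |ℓ(x) - β|` where the equation `ℓ(y) = β` cuts out `H` from `A = aff(x, H)` and `ℓ` is
primitive on the lattice of the linear space parallel to `A`. Since `ℓ` is defined on all of `ℝⁿ`,
a translation of `A` to the origin only changes `β` by a constant. For `x ∉ H` the pair `(ℓ|_A, β)`
is unique up to sign and an additive constant in both entries, so `h` is unique. -/
def IsHeight (H : AffineSubspace ℝ (Fin n → ℝ)) (x : Fin n → ℝ) (h : ℝ) : Prop :=
  ∃ (ℓ : (Fin n → ℝ) →ₗ[ℝ] ℝ) (β : ℝ),
    IsPrimitiveOn ℓ (affineSpan ℝ (insert x (H : Set (Fin n → ℝ)))).direction ∧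
    (∀ y ∈ affineSpan ℝ (insert x (H : Set (Fin n → ℝ))), y ∈ H ↔ ℓ y = β) ∧
    h = |ℓ x - β|

/-- The lattice height of `x` over the affine subspace `H`. -/
def heightOver (H : AffineSubspace ℝ (Fin n → ℝ)) (x : Fin n → ℝ) : ℝ :=
  open Classical in
  if x ∈ H then 0 else Classical.epsilon (IsHeight H x)

/-- The lattice height of `x` over a polytope `F`, i.e. over the affine hull of `F`. -/
def height (F : Set (Fin n → ℝ)) (x : Fin n → ℝ) : ℝ :=
  heightOver (affineSpan ℝ F) x

/-- The facets of a polytope `P`: the nonempty faces of dimension `dim P - 1`. A nonempty subset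
is exposed in the sense of `IsExposed` iff a linear form attains its maximum on `P` exactly
there. -/
def facets (P : Set (Fin n → ℝ)) : Set (Set (Fin n → ℝ)) :=
  {F | F.Nonempty ∧ IsExposed ℝ P F ∧ dim F + 1 = dim P}

/-- The cone `ℝ₊v₁ + ⋯ + ℝ₊v_m`. -/
def cone {m : ℕ} (v : Fin m → Fin n → ℤ) : Set (Fin n → ℝ) :=
  {x | ∃ c : Fin m → ℝ, (∀ i, 0 ≤ c i) ∧ x = ∑ i, c i • intCast n (v i)}

/-- The cross-section `P = {x ∈ C : δ(x) = 1}`. -/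
def crossSection (C : Set (Fin n → ℝ)) (δ : (Fin n → ℤ) →ₗ[ℤ] ℤ) : Set (Fin n → ℝ) :=
  {x | x ∈ C ∧ realForm δ x = 1}

/-- `conv(0, P)`. -/
def bar (P : Set (Fin n → ℝ)) : Set (Fin n → ℝ) :=
  convexHull ℝ (insert 0 P)

/-- The lattice `aff(conv(0, P)) ∩ ℤⁿ`. As `0` lies in `conv(0, P)`, its affine hull is a linear
subspace and equals its direction. -/
def barLattice (P : Set (Fin n → ℝ)) : Submodule ℤ (Fin n → ℤ) :=
  lattice (affineSpan ℝ (bar P)).direction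

end LatticeVolume

end

noncomputable section

namespace LatticeVolume

open Module Submodule
open scoped Pointwise

/-! ### Rational subspaces, primitive forms and lattice heights. -/

section

variable {n : ℕ}

/-! Let `W` be the linear hull of the cone `C`, a rational subspace of dimension `d + 1`. A facet
`F` of `P` spans a rational hyperplane of `W`, which is the kernel of a primitive form `l F` on `W`,
nonnegative on `C` (`exists_isFacetForm`). By `heightOver_eq` the lattice height over `bar F` is the
value of this form.

For claim 1 take the apex `p = v/δ(v)` in `P`. The pyramids over the sets `bar F` with apex `p`
cover `bar P`: from a point `y` move in direction `-p` until the boundary of the cone is reached;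
the endpoint lies over some facet (`bar_crossSection_eq_biUnion`, which needs that the facet forms
cut out the cone, `mem_cone_of_facetForms`). Two different pyramids overlap in a null set
(`measure_inter_pyramids_eq_zero`). By `relVol_pyramid` each has volume `l F p` times that of `bar
F`: Fubini gives a constant that does not depend on the base, the unimodular simplex of `W` is
itself a pyramid over that of the hyperplane and fixes this constant, and a transvection moves the
apex. Finally `l F p = l F v / δ(v)`.

For claim 2, an integral form divided by the gcd of its values on a lattice basis is primitive
(`isPrimitiveOn_div_gcd`), and heights may be computed with any primitive form that has the right
kernel.

For claim 3, `bar P` is the simplex with vertices `0` and `vᵢ/δ(vᵢ)`, whose volume is a determinant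
(`relVol_simplex`). -/

@[simp] theorem intCast_apply (z : Fin n → ℤ) (i : Fin n) : intCast n z i = z i := rfl

theorem intCast_injective : Function.Injective (intCast n) := fun x y h => by
  ext i; simpa using congrFun h i

theorem intCast_zsmul (k : ℤ) (z : Fin n → ℤ) : intCast n (k • z) = (k : ℝ) • intCast n z := by
  ext i; simp

@[simp] theorem realForm_intCast (φ : (Fin n → ℤ) →ₗ[ℤ] ℤ) (z : Fin n → ℤ) :
    realForm φ (intCast n z) = φ z := by
  conv_rhs => rw [← (Pi.basisFun ℤ (Fin n)).sum_repr z]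
  rw [map_sum]
  simp only [realForm, Basis.constr_apply_fintype, map_smul]
  simp

theorem lattice_mono {V W : Submodule ℝ (Fin n → ℝ)} (h : V ≤ W) : lattice V ≤ lattice W :=
  fun _ hz => h hz

theorem intCast_mem_span_int (z : Fin n → ℤ) :
    intCast n z ∈ span ℤ (Set.range (Pi.basisFun ℝ (Fin n))) := by
  rw [(Pi.basisFun ℝ (Fin n)).mem_span_iff_repr_mem ℤ]
  intro i
  exact ⟨z i, by simp⟩

/-- Integral vectors that are linearly independent over `ℤ` are so over `ℝ`. -/
theorem linearIndependent_intCast {ι : Type*} [Fintype ι] {v : ι → Fin n → ℤ}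
    (h : LinearIndependent ℤ v) : LinearIndependent ℝ fun i => intCast n (v i) := by
  have hli : LinearIndependent ℤ fun i => intCast n (v i) :=
    h.map' (intCast n) (LinearMap.ker_eq_bot.2 intCast_injective)
  have hle : span ℤ (Set.range fun i => intCast n (v i)) ≤
      span ℤ (Set.range (Pi.basisFun ℝ (Fin n))) := by
    rw [span_le]
    rintro _ ⟨i, rfl⟩
    exact intCast_mem_span_int _
  -- For a discrete subgroup the rank over `ℤ` equals the dimension of the real span.
  have hd : DiscreteTopology (span ℤ (Set.range fun i => intCast n (v i))) :=
    DiscreteTopology.of_subset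
      (inferInstanceAs (DiscreteTopology (span ℤ (Set.range (Pi.basisFun ℝ (Fin n)))))) hle
  rw [linearIndependent_iff_card_eq_finrank_span, Real.finrank_eq_int_finrank_of_discrete hd]
  exact (finrank_span_eq_card hli).symm

/-- A linear subspace is rational if it is spanned by integral vectors. -/
def IsRational (W : Submodule ℝ (Fin n → ℝ)) : Prop :=
  W ≤ span ℝ (intCast n '' (lattice W : Set (Fin n → ℤ)))

theorem isRational_span (s : Set (Fin n → ℤ)) : IsRational (span ℝ (intCast n '' s)) :=
  span_mono (Set.image_mono fun _ hz => subset_span (Set.mem_image_of_mem _ hz))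

/-- A `ℤ`-basis of `W ∩ ℤⁿ` is an `ℝ`-basis of a rational subspace `W`. -/
def realBasis {W : Submodule ℝ (Fin n → ℝ)} (hW : IsRational W) {ι : Type*} [Fintype ι]
    (b : Basis ι ℤ (lattice W)) : Basis ι ℝ W :=
  Basis.mk (v := fun i => (⟨intCast n (b i), (b i).2⟩ : W))
    (by
      refine LinearIndependent.of_comp W.subtype ?_
      exact linearIndependent_intCast
        (b.linearIndependent.map' (lattice W).subtype (ker_subtype _)))
    (by
      rintro ⟨y, hy⟩ -
      have hle : span ℝ (intCast n '' (lattice W : Set (Fin n → ℤ))) ≤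
          (span ℝ (Set.range fun i => (⟨intCast n (b i), (b i).2⟩ : W))).map W.subtype := by
        rw [span_le]
        rintro _ ⟨z, hz, rfl⟩
        refine ⟨⟨intCast n z, hz⟩, ?_, rfl⟩
        have hz' := b.sum_repr ⟨z, hz⟩
        have : (⟨intCast n z, hz⟩ : W) =
            ∑ i, ((b.repr ⟨z, hz⟩ i : ℤ) : ℝ) • (⟨intCast n (b i), (b i).2⟩ : W) := by
          apply Subtype.ext
          have h := congrArg (fun w : lattice W => intCast n (w : Fin n → ℤ)) hz'
          simp only [AddSubmonoidClass.coe_finsetSum, map_sum, coe_smul_of_tower,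
            intCast_zsmul] at h
          simp only [AddSubmonoidClass.coe_finsetSum, coe_smul]
          exact h.symm
        rw [this]
        exact sum_mem fun i _ => smul_mem _ _ (subset_span ⟨i, rfl⟩)
      obtain ⟨w, hw, rfl⟩ := hle (hW hy)
      exact hw)

@[simp] theorem coe_realBasis {W : Submodule ℝ (Fin n → ℝ)} (hW : IsRational W) {ι : Type*}
    [Fintype ι] (b : Basis ι ℤ (lattice W)) (i : ι) :
    (realBasis hW b i : Fin n → ℝ) = intCast n (b i) := by
  simp [realBasis]

theorem finrank_lattice {W : Submodule ℝ (Fin n → ℝ)} (hW : IsRational W) :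
    finrank ℤ (lattice W) = finrank ℝ W := by
  rw [finrank_eq_card_basis (realBasis hW (finBasis ℤ (lattice W))), Fintype.card_fin]

/-- Because of `e`, the space `W ∩ ker l` is proper in `W`; it contains `V`, which has codimension
one, so the two coincide. -/
theorem mem_of_form_eq_zero {V W : Submodule ℝ (Fin n → ℝ)} (hVW : V ≤ W)
    (hfin : finrank ℝ V + 1 = finrank ℝ W) {l : (Fin n → ℝ) →ₗ[ℝ] ℝ} (hl : ∀ y ∈ V, l y = 0)
    {e : Fin n → ℝ} (he : e ∈ W) (hle : l e ≠ 0) {y : Fin n → ℝ} (hy : y ∈ W) (hly : l y = 0) :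
    y ∈ V := by
  have hlt : W ⊓ LinearMap.ker l < W :=
    lt_of_le_of_ne inf_le_left fun h => hle (by
      have : e ∈ W ⊓ LinearMap.ker l := h.symm ▸ he
      exact this.2)
  have h1 := finrank_lt_finrank_of_lt hlt
  have h2 : V = W ⊓ LinearMap.ker l :=
    eq_of_le_of_finrank_le (le_inf hVW fun y hy => hl y hy) (by omega)
  rw [h2]
  exact ⟨hy, hly⟩

/-- A rational hyperplane of a rational subspace is cut out by a primitive form. -/
theorem exists_isPrimitiveOn {V W : Submodule ℝ (Fin n → ℝ)} (hV : IsRational V)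
    (hW : IsRational W) (hVW : V ≤ W) (hfin : finrank ℝ V + 1 = finrank ℝ W) :
    ∃ l : (Fin n → ℝ) →ₗ[ℝ] ℝ, IsPrimitiveOn l W ∧ ∀ y ∈ W, l y = 0 ↔ y ∈ V := by
  set N : Submodule ℤ (lattice W) := (lattice V).submoduleOf (lattice W) with hN
  -- `V` is a real subspace, so `k • z ∈ V` with `k ≠ 0` forces `z ∈ V`. Hence the quotient is free
  -- of rank one, and its coordinate is the primitive form.
  have htf : IsTorsionFree ℤ (lattice W ⧸ N) := by
    rw [isTorsionFree_iff_smul_eq_zero]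
    intro k q hkq
    obtain ⟨z, rfl⟩ := N.mkQ_surjective q
    by_cases hk : k = 0
    · exact Or.inl hk
    right
    rw [← map_smul, mkQ_apply, Quotient.mk_eq_zero] at hkq
    rw [mkQ_apply, Quotient.mk_eq_zero]
    have h1 : intCast n (k • (z : Fin n → ℤ)) ∈ V := hkq
    rw [intCast_zsmul, V.smul_mem_iff (Int.cast_ne_zero.2 hk)] at h1
    exact h1
  have hNfin : finrank ℤ N = finrank ℤ (lattice V) :=
    (submoduleOfEquivOfLe (lattice_mono hVW)).finrank_eq
  have hQ : finrank ℤ (lattice W ⧸ N) = 1 := by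
    have := N.finrank_quotient_add_finrank
    rw [hNfin, finrank_lattice hV, finrank_lattice hW] at this
    omega
  let q : Basis (Fin 1) ℤ (lattice W ⧸ N) := finBasisOfFinrankEq ℤ _ hQ
  let f : lattice W →ₗ[ℤ] ℤ := q.coord 0 ∘ₗ N.mkQ
  have hf0 : ∀ z ∈ lattice V, ∀ hz : z ∈ lattice W, f ⟨z, hz⟩ = 0 := by
    intro z hz hzW
    have : N.mkQ ⟨z, hzW⟩ = 0 := by
      rw [mkQ_apply, Quotient.mk_eq_zero]
      exact hz
    simp only [f, LinearMap.comp_apply, this, map_zero]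
  obtain ⟨e, he⟩ := N.mkQ_surjective (q 0)
  have hfe : f e = 1 := by
    simp only [f, LinearMap.comp_apply, he]
    simp
  let b := finBasis ℤ (lattice W)
  obtain ⟨l, hl⟩ := ((realBasis hW b).constr ℝ fun i => (f (b i) : ℝ)).exists_extend
  have hlf : ∀ z (hz : z ∈ lattice W), l (intCast n z) = f ⟨z, hz⟩ := by
    have : (l.restrictScalars ℤ) ∘ₗ intCast n ∘ₗ (lattice W).subtype =
        (Int.castAddHom ℝ).toIntLinearMap ∘ₗ f := by
      refine b.ext fun i => ?_
      have h := LinearMap.congr_fun hl (realBasis hW b i)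
      simp only [LinearMap.comp_apply, subtype_apply, coe_realBasis, Basis.constr_basis] at h
      simpa using h
    intro z hz
    simpa using LinearMap.congr_fun this ⟨z, hz⟩
  have hle : l (intCast n (e : Fin n → ℤ)) = 1 := by rw [hlf _ e.2, hfe]; simp
  have hlV : ∀ y ∈ V, l y = 0 := by
    intro y hy
    have : span ℝ (intCast n '' (lattice V : Set (Fin n → ℤ))) ≤ LinearMap.ker l := by
      rw [span_le]
      rintro _ ⟨z, hz, rfl⟩
      have := hlf z (lattice_mono hVW hz)
      rw [hf0 z hz] at this
      simpa using this
    exact this (hV hy)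
  refine ⟨l, ⟨fun z hz => ⟨_, hlf z hz⟩, e, e.2, hle⟩, fun y hy => ⟨fun h => ?_, hlV y⟩⟩
  exact mem_of_form_eq_zero hVW hfin hlV e.2 (by rw [hle]; exact one_ne_zero) hy h

theorem affineSpan_eq_span {s : Set (Fin n → ℝ)} (h0 : (0 : Fin n → ℝ) ∈ s) :
    affineSpan ℝ s = (span ℝ s).toAffineSubspace := by
  have h := affineSpan_insert_zero (k := ℝ) s
  rw [Set.insert_eq_of_mem h0] at h
  exact SetLike.coe_injective h

theorem affineSpan_insert_eq {V W : Submodule ℝ (Fin n → ℝ)} (hVW : V ≤ W)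
    (hfin : finrank ℝ V + 1 = finrank ℝ W) {x : Fin n → ℝ} (hx : x ∈ W) (hxV : x ∉ V) :
    affineSpan ℝ (insert x (V : Set (Fin n → ℝ))) = W.toAffineSubspace := by
  have h0 : (0 : Fin n → ℝ) ∈ insert x (V : Set (Fin n → ℝ)) := Or.inr V.zero_mem
  rw [affineSpan_eq_span h0]
  congr 1
  refine eq_of_le_of_finrank_le ?_ ?_
  · rw [span_le]
    exact Set.insert_subset hx hVW
  · rw [← hfin]
    refine Nat.succ_le_of_lt (finrank_lt_finrank_of_lt (lt_of_le_of_ne ?_ ?_))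
    · exact fun y hy => subset_span (Or.inr hy)
    · intro h
      exact hxV (h ▸ subset_span (Or.inl rfl))

/-- The lattice height over a hyperplane of `W` is given by a primitive form on `W`. -/
theorem heightOver_eq {V W : Submodule ℝ (Fin n → ℝ)} (hVW : V ≤ W)
    (hfin : finrank ℝ V + 1 = finrank ℝ W) {l : (Fin n → ℝ) →ₗ[ℝ] ℝ} (hl : IsPrimitiveOn l W)
    (hker : ∀ y ∈ W, l y = 0 ↔ y ∈ V) {x : Fin n → ℝ} (hx : x ∈ W) :
    heightOver V.toAffineSubspace x = |l x| := by
  unfold heightOver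
  by_cases hxV : x ∈ V
  · rw [if_pos (mem_toAffineSubspace.2 hxV), (hker x hx).2 hxV, abs_zero]
  rw [if_neg (mt mem_toAffineSubspace.1 hxV)]
  have hspan := affineSpan_insert_eq hVW hfin hx hxV
  have hex : IsHeight V.toAffineSubspace x |l x| := by
    refine ⟨l, 0, ?_, ?_, by simp⟩
    · erw [hspan]
      simpa using hl
    · erw [hspan]
      exact fun y hy => (hker y hy).symm
  obtain ⟨l', β, hl', hcut, hh⟩ := Classical.epsilon_spec (p := IsHeight V.toAffineSubspace x) ⟨_, hex⟩
  rw [hh]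
  erw [hspan] at hl' hcut
  rw [Submodule.toAffineSubspace_direction] at hl'
  -- The hyperplane passes through the origin.
  have hβ : β = 0 := by
    have := (hcut 0 W.zero_mem).1 V.zero_mem
    simpa using this.symm
  subst hβ
  obtain ⟨hint, e, he, hle⟩ := hl
  obtain ⟨hint', e', he', hle'⟩ := hl'
  have hprop : ∀ y ∈ W, l' y = l y * l' (intCast n e) := by
    intro y hy
    have hmem : y - l y • intCast n e ∈ V := by
      refine (hker _ (W.sub_mem hy (W.smul_mem _ he))).1 ?_
      simp [hle]
    have := (hcut _ (W.sub_mem hy (W.smul_mem _ he))).1 hmem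
    rw [map_sub, map_smul, smul_eq_mul] at this
    linarith
  -- The proportionality factor `k` of the two primitive forms has the integral inverse `j`, so it
  -- is `±1`.
  obtain ⟨k, hk⟩ := hint' e he
  obtain ⟨j, hj⟩ := hint e' he'
  have h1 := hprop _ he'
  rw [hle', hj, hk] at h1
  have h2 : j * k = 1 := by exact_mod_cast h1.symm
  have h3 : |k| = 1 := Int.isUnit_iff_abs_eq.1 (IsUnit.of_mul_eq_one j (by rw [mul_comm]; exact h2))
  have h4 : |(k : ℝ)| = 1 := by exact_mod_cast h3
  rw [sub_zero, hprop x hx, hk, abs_mul, h4, mul_one]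

end

/-! ### Volumes of pyramids and simplices, normalized by a lattice. -/

section

variable {n : ℕ}

section Pyramid

/-- The slice of the pyramid at height `t` is the base shrunk by `1 - t`; this is the input for
Fubini. -/
theorem mem_convexHull_insert_prod {V : Type*} [AddCommGroup V] [Module ℝ V] {B : Set V}
    (hB : Convex ℝ B) (hne : B.Nonempty) {x : V × ℝ} :
    x ∈ convexHull ℝ (insert (0, 1) (B ×ˢ {(0 : ℝ)})) ↔
      x.2 ∈ Set.Icc (0 : ℝ) 1 ∧ x.1 ∈ (1 - x.2) • B := by
  have hconv : Convex ℝ (B ×ˢ {(0 : ℝ)}) := hB.prod (convex_singleton 0)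
  rw [convexHull_insert (hne.prod (Set.singleton_nonempty _)), hconv.convexHull_eq]
  simp only [convexJoin_singleton_left, Set.mem_iUnion, Set.mem_prod, Set.mem_singleton_iff]
  constructor
  · rintro ⟨⟨b, s⟩, ⟨hb, hs⟩, p, q, hp, hq, hpq, rfl⟩
    simp only at hb hs
    subst hs
    refine ⟨?_, b, hb, ?_⟩
    · simp only [Prod.smul_mk, Prod.mk_add_mk, smul_eq_mul, mul_one, mul_zero, add_zero, Set.mem_Icc]
      constructor <;> linarith
    · simp only [Prod.smul_mk, Prod.mk_add_mk, smul_eq_mul, mul_one, mul_zero, add_zero, smul_zero,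
        zero_add]
      rw [← hpq, add_sub_cancel_left]
  · rintro ⟨⟨h0, h1⟩, b, hb, hx⟩
    refine ⟨(b, 0), ⟨hb, rfl⟩, x.2, 1 - x.2, h0, by linarith, by ring, ?_⟩
    ext
    · simpa using hx
    · simp

/-- The measure of a pyramid with a fixed apex is proportional to the measure of its base. -/
theorem exists_measure_pyramid_eq {V W : Type*} [NormedAddCommGroup V] [NormedSpace ℝ V]
    [FiniteDimensional ℝ V] [MeasurableSpace V] [BorelSpace V] [NormedAddCommGroup W]
    [NormedSpace ℝ W] [FiniteDimensional ℝ W] [MeasurableSpace W] [BorelSpace W]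
    (μ : Measure V) [μ.IsAddHaarMeasure] (ν : Measure W) [ν.IsAddHaarMeasure]
    (Φ : (V × ℝ) ≃ₗ[ℝ] W) :
    ∃ K : ENNReal, ∀ B : Set V, Convex ℝ B → IsCompact B → B.Nonempty →
      ν (Φ '' convexHull ℝ (insert (0, 1) (B ×ˢ {(0 : ℝ)}))) = K * μ B := by
  let e : (V × ℝ) ≃L[ℝ] W := Φ.toContinuousLinearEquiv
  have hhaar : (ν.map e.symm).IsAddHaarMeasure := e.symm.isAddHaarMeasure_map ν
  -- By uniqueness of Haar measure. Together with the integral of the shrinking factors of the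
  -- slices, `c` makes up a constant independent of `B`.
  obtain ⟨c, hc⟩ : ∃ c : ENNReal, ν.map e.symm = c • μ.prod volume :=
    ⟨_, Measure.isAddLeftInvariant_eq_smul _ _⟩
  refine ⟨c * ∫⁻ t in Set.Icc (0 : ℝ) 1, ENNReal.ofReal |(1 - t) ^ finrank ℝ V|,
    fun B hB hBc hne => ?_⟩
  have hcomp : IsCompact (convexHull ℝ (insert ((0 : V), (1 : ℝ)) (B ×ˢ {(0 : ℝ)}))) := by
    have himg : convexHull ℝ (insert ((0 : V), (1 : ℝ)) (B ×ˢ {(0 : ℝ)})) =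
        (fun p : V × ℝ => ((1 - p.2) • p.1, p.2)) '' (B ×ˢ Set.Icc (0 : ℝ) 1) := by
      ext x
      rw [mem_convexHull_insert_prod hB hne]
      constructor
      · rintro ⟨ht, b, hb, hx⟩
        exact ⟨(b, x.2), ⟨hb, ht⟩, Prod.ext hx rfl⟩
      · rintro ⟨⟨b, t⟩, ⟨hb, ht⟩, rfl⟩
        exact ⟨ht, b, hb, rfl⟩
    rw [himg]
    exact (hBc.prod isCompact_Icc).image (by fun_prop)
  have hmeas := hcomp.measurableSet
  have h1 : ν (Φ '' convexHull ℝ (insert (0, 1) (B ×ˢ {(0 : ℝ)}))) =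
      ν.map e.symm (convexHull ℝ (insert (0, 1) (B ×ˢ {(0 : ℝ)}))) := by
    rw [Measure.map_apply e.symm.continuous.measurable hmeas]
    congr 1
    exact e.image_eq_preimage_symm _
  rw [h1, hc, Measure.smul_apply, smul_eq_mul, Measure.prod_apply_symm hmeas, mul_assoc]
  congr 1
  rw [← lintegral_mul_const _ (by fun_prop), ← lintegral_indicator measurableSet_Icc]
  refine lintegral_congr fun t => ?_
  by_cases ht : t ∈ Set.Icc (0 : ℝ) 1
  · rw [Set.indicator_of_mem ht, ← Measure.addHaar_smul]
    congr 1
    ext v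
    rw [Set.mem_preimage, mem_convexHull_insert_prod hB hne]
    exact ⟨fun h => h.2, fun h => ⟨ht, h⟩⟩
  · rw [Set.indicator_of_notMem ht]
    refine (congrArg μ (Set.eq_empty_iff_forall_notMem.2 fun v => ?_)).trans measure_empty
    rw [Set.mem_preimage, mem_convexHull_insert_prod hB hne]
    exact fun h => ht h.1

end Pyramid

/-- The volume of the part of `X` in `W`, normalized by the lattice `W ∩ ℤⁿ`. -/
def relVol (W : Submodule ℝ (Fin n → ℝ)) (X : Set (Fin n → ℝ)) : ℝ :=
  (Measure.addHaar : Measure W).real {y : W | (y : Fin n → ℝ) ∈ X} /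
    (Measure.addHaar : Measure W).real (unimodularSimplex W)

/-- As `0 ∈ X`, the base point chosen in `vol` lies in the linear span, and translation invariance
removes it. -/
theorem vol_eq_relVol {X : Set (Fin n → ℝ)} (h0 : (0 : Fin n → ℝ) ∈ X) :
    vol X = relVol (span ℝ X) X := by
  have hX : X.Nonempty := ⟨0, h0⟩
  -- The subspace is a variable here because the type of the measure depends on it.
  have key : ∀ W : Submodule ℝ (Fin n → ℝ), W = span ℝ X →
      (Measure.addHaar : Measure W).real {y | hX.some + (y : Fin n → ℝ) ∈ X} /
        (Measure.addHaar : Measure W).real (unimodularSimplex W) = relVol (span ℝ X) X := by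
    rintro _ rfl
    let s : span ℝ X := ⟨hX.some, subset_span hX.some_mem⟩
    have h := measure_preimage_add (Measure.addHaar : Measure (span ℝ X)) s
      {y | (y : Fin n → ℝ) ∈ X}
    rw [relVol, measureReal_def, measureReal_def _ {y : span ℝ X | (y : Fin n → ℝ) ∈ X}, ← h]
    rfl
  unfold vol
  rw [dif_pos hX]
  exact key _ (by rw [affineSpan_eq_span h0, toAffineSubspace_direction])

theorem preimage_coe_convexHull {W : Submodule ℝ (Fin n → ℝ)} (S : Set W) :
    {y : W | (y : Fin n → ℝ) ∈ convexHull ℝ ((fun w : W => (w : Fin n → ℝ)) '' S)} =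
      convexHull ℝ S := by
  have h := W.subtype.image_convexHull S
  have h2 : (fun w : W => (w : Fin n → ℝ)) = W.subtype := rfl
  rw [h2, ← h]
  exact Set.preimage_image_eq _ Subtype.val_injective

theorem preimage_coe_simplex {W : Submodule ℝ (Fin n → ℝ)} {ι : Type*} (p : ι → W) :
    {y : W | (y : Fin n → ℝ) ∈ convexHull ℝ
      (insert (0 : Fin n → ℝ) (Set.range fun i => (p i : Fin n → ℝ)))} =
      convexHull ℝ (insert 0 (Set.range p)) := by
  rw [← preimage_coe_convexHull, Set.image_insert_eq, ← Set.range_comp]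
  rfl

theorem unimodularSimplex_eq {W : Submodule ℝ (Fin n → ℝ)} (hW : IsRational W) :
    unimodularSimplex W =
      convexHull ℝ (insert 0 (Set.range (realBasis hW (finBasis ℤ (lattice W))))) := by
  rw [← preimage_coe_simplex]
  simp only [coe_realBasis]
  rfl

section Simplex

variable {W : Type*} [NormedAddCommGroup W] [NormedSpace ℝ W] [FiniteDimensional ℝ W]
  [MeasurableSpace W] (μ : Measure W) [μ.IsAddHaarMeasure]
  {ι : Type*} [Fintype ι]

/-- The linear map taking `u i` to `p i` carries one simplex to the other. -/
theorem measure_convexHull_insert_zero [BorelSpace W] [DecidableEq ι] (u : Basis ι ℝ W) (p : ι → W) :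
    μ.real (convexHull ℝ (insert 0 (Set.range p))) =
      |(u.toMatrix p).det| * μ.real (convexHull ℝ (insert 0 (Set.range u))) := by
  have himg : convexHull ℝ (insert 0 (Set.range p)) =
      u.constr ℝ p '' convexHull ℝ (insert 0 (Set.range u)) := by
    rw [LinearMap.image_convexHull, Set.image_insert_eq, map_zero, ← Set.range_comp]
    congr 3
    ext i
    simp
  have hdet : LinearMap.det (u.constr ℝ p) = (u.toMatrix p).det := by
    rw [← LinearMap.det_toMatrix u]
    congr 1
    ext i j
    simp [LinearMap.toMatrix_apply, Basis.toMatrix_apply]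
  rw [himg, measureReal_def, Measure.addHaar_image_linearMap, ENNReal.toReal_mul, hdet,
    ENNReal.toReal_ofReal (abs_nonneg _), measureReal_def]

theorem measure_convexHull_basis_pos (u : Basis ι ℝ W) :
    0 < μ.real (convexHull ℝ (insert 0 (Set.range u))) := by
  have hfin : (insert 0 (Set.range u)).Finite := (Set.finite_range u).insert 0
  have hlt : μ (convexHull ℝ (insert 0 (Set.range u))) ≠ ⊤ :=
    (hfin.isCompact_convexHull ℝ).measure_lt_top.ne
  refine ENNReal.toReal_pos ?_ hlt
  have hint : (interior (convexHull ℝ (insert 0 (Set.range u)))).Nonempty := by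
    rw [interior_convexHull_nonempty_iff_affineSpan_eq_top]
    apply SetLike.coe_injective
    rw [affineSpan_insert_zero, u.span_eq]
    rfl
  exact (Measure.measure_pos_of_nonempty_interior μ hint).ne'

end Simplex

theorem realBasis_repr {W : Submodule ℝ (Fin n → ℝ)} (hW : IsRational W) {ι : Type*} [Fintype ι]
    (b : Basis ι ℤ (lattice W)) (z : lattice W) (i : ι) :
    (realBasis hW b).repr ⟨intCast n z, z.2⟩ i = b.repr z i := by
  have : (⟨intCast n z, z.2⟩ : W) = ∑ i, ((b.repr z i : ℤ) : ℝ) • realBasis hW b i := by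
    apply Subtype.ext
    have h := congrArg (fun w : lattice W => intCast n (w : Fin n → ℤ)) (b.sum_repr z)
    simp only [AddSubmonoidClass.coe_finsetSum, map_sum, coe_smul_of_tower,
      intCast_zsmul] at h
    simp only [AddSubmonoidClass.coe_finsetSum, coe_smul, coe_realBasis]
    exact h.symm
  rw [this, Basis.repr_sum_self]

/-- Two `ℤ`-bases differ by an integral matrix of determinant `±1`, so the basis chosen in
`unimodularSimplex` is immaterial. -/
theorem measure_simplex_eq {W : Submodule ℝ (Fin n → ℝ)} (hW : IsRational W) {ι : Type*}
    [Fintype ι] (b : Basis ι ℤ (lattice W)) (μ : Measure W) [μ.IsAddHaarMeasure] :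
    μ.real (convexHull ℝ (insert 0 (Set.range (realBasis hW b)))) =
      μ.real (unimodularSimplex W) := by
  classical
  rw [unimodularSimplex_eq hW]
  let b₀ := finBasis ℤ (lattice W)
  let e := b.indexEquiv b₀
  have hr : Set.range (realBasis hW b) = Set.range (realBasis hW b ∘ e.symm) := by
    rw [e.symm.surjective.range_comp]
  rw [hr, measure_convexHull_insert_zero μ (realBasis hW b₀)]
  have hdet : ((realBasis hW b₀).toMatrix (realBasis hW b ∘ e.symm)) =
      (b₀.toMatrix (b.reindex e)).map (Int.castRingHom ℝ) := by
    ext i j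
    rw [Basis.toMatrix_apply, Matrix.map_apply, Basis.toMatrix_apply, Basis.reindex_apply]
    have := realBasis_repr hW b₀ (b (e.symm j)) i
    refine Eq.trans ?_ this
    have hb : realBasis hW b (e.symm j) = ⟨intCast n (b (e.symm j)), (b (e.symm j)).2⟩ :=
      Subtype.ext (coe_realBasis hW b _)
    rw [Function.comp_apply, hb]
  have h1 : |(b₀.toMatrix (b.reindex e)).det| = 1 :=
    Int.isUnit_iff_abs_eq.1 (b₀.isUnit_det (b.reindex e))
  have h2 : |(((b₀.toMatrix (b.reindex e)).det : ℤ) : ℝ)| = 1 := by exact_mod_cast h1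
  have h3 := (Int.castRingHom ℝ).map_det (b₀.toMatrix (b.reindex e))
  rw [hdet]
  rw [RingHom.mapMatrix_apply] at h3
  rw [← h3, Int.coe_castRingHom, h2, one_mul]

theorem measure_unimodularSimplex_pos {W : Submodule ℝ (Fin n → ℝ)} (hW : IsRational W)
    (μ : Measure W) [μ.IsAddHaarMeasure] : 0 < μ.real (unimodularSimplex W) := by
  rw [unimodularSimplex_eq hW]
  exact measure_convexHull_basis_pos μ _

/-- The normalized volume of a simplex with vertex `0`. -/
theorem relVol_simplex {W : Submodule ℝ (Fin n → ℝ)} (hW : IsRational W) {ι : Type*}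
    [Fintype ι] [DecidableEq ι] (u : Basis ι ℤ (lattice W)) (p : ι → W) :
    relVol W (convexHull ℝ (insert 0 (Set.range fun i => (p i : Fin n → ℝ)))) =
      |((realBasis hW u).toMatrix p).det| := by
  rw [relVol, preimage_coe_simplex, measure_convexHull_insert_zero _ (realBasis hW u),
    measure_simplex_eq, mul_div_assoc, div_self (measure_unimodularSimplex_pos hW _).ne', mul_one]

end

/-! ### The volume of a pyramid as height times volume of the base. -/

section

variable {n : ℕ}

theorem convexHull_insert_convexHull {E : Type*} [AddCommGroup E] [Module ℝ E] (x : E) (s : Set E) :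
    convexHull ℝ (insert x (convexHull ℝ s)) = convexHull ℝ (insert x s) := by
  rw [Set.insert_eq, convexHull_convexHull_union_right, ← Set.insert_eq]

/-- If a primitive form on `W` has kernel `V` and takes the value `1` at `e`, then `e` and a basis
of the lattice of `V` form a basis of the lattice of `W`. -/
def latticeConsBasis {V W : Submodule ℝ (Fin n → ℝ)} (hVW : V ≤ W)
    {l : (Fin n → ℝ) →ₗ[ℝ] ℝ} (hint : ∀ z ∈ lattice W, ∃ k : ℤ, l (intCast n z) = k)
    (hker : ∀ y ∈ W, l y = 0 ↔ y ∈ V) {e : Fin n → ℤ} (he : e ∈ lattice W)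
    (hle : l (intCast n e) = 1) {r : ℕ} (b : Basis (Fin r) ℤ (lattice V)) :
    Basis (Fin (r + 1)) ℤ (lattice W) :=
  Basis.mkFinConsOfLE e he b (lattice_mono hVW)
    (fun c x hx h => by
      have h1 := congrArg (fun z => l (intCast n z)) h
      rw [map_add, intCast_zsmul, map_add, map_smul, hle, (hker _ (hVW hx)).2 hx] at h1
      simpa using h1)
    (fun z hz => by
      obtain ⟨k, hk⟩ := hint z hz
      refine ⟨-k, ?_⟩
      have hmem : z + -k • e ∈ lattice W := add_mem hz ((lattice W).smul_mem _ he)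
      refine (hker _ hmem).1 ?_
      rw [map_add, intCast_zsmul, map_add, map_smul, hle, hk]
      simp)

theorem range_realBasis_latticeConsBasis {V W : Submodule ℝ (Fin n → ℝ)} (hV : IsRational V)
    (hW : IsRational W) (hVW : V ≤ W)
    {l : (Fin n → ℝ) →ₗ[ℝ] ℝ} (hint : ∀ z ∈ lattice W, ∃ k : ℤ, l (intCast n z) = k)
    (hker : ∀ y ∈ W, l y = 0 ↔ y ∈ V) {e : Fin n → ℤ} (he : e ∈ lattice W)
    (hle : l (intCast n e) = 1) {r : ℕ} (b : Basis (Fin r) ℤ (lattice V)) :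
    Set.range (realBasis hW (latticeConsBasis hVW hint hker he hle b)) =
      insert ⟨intCast n e, he⟩ (inclusion hVW '' Set.range (realBasis hV b)) := by
  have : ⇑(realBasis hW (latticeConsBasis hVW hint hker he hle b)) =
      Fin.cons ⟨intCast n e, he⟩ (inclusion hVW ∘ realBasis hV b) := by
    funext i
    apply Subtype.ext
    rw [coe_realBasis, latticeConsBasis, Basis.coe_mkFinConsOfLE]
    refine Fin.cases ?_ (fun i => ?_) i
    · rfl
    · simp
  rw [this, Fin.range_cons, Set.range_comp]

/-- The normalized volume of a pyramid is the lattice height of its apex times the normalized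
volume of its base. -/
theorem relVol_pyramid {V W : Submodule ℝ (Fin n → ℝ)} (hV : IsRational V) (hW : IsRational W)
    (hVW : V ≤ W) {l : (Fin n → ℝ) →ₗ[ℝ] ℝ} (hl : IsPrimitiveOn l W)
    (hker : ∀ y ∈ W, l y = 0 ↔ y ∈ V) {B : Set (Fin n → ℝ)} (hBV : B ⊆ V) (hB : Convex ℝ B)
    (hBc : IsCompact B) (hne : B.Nonempty) {p : Fin n → ℝ} (hp : p ∈ W) :
    relVol W (convexHull ℝ (insert p B)) = |l p| * relVol V B := by
  obtain ⟨hint, e, he, hle⟩ := hl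
  let j : V →ₗ[ℝ] W := inclusion hVW
  let eW : W := ⟨intCast n e, he⟩
  let pW : W := ⟨p, hp⟩
  let lW : W →ₗ[ℝ] ℝ := l ∘ₗ W.subtype
  have hlj : ∀ x, lW (j x) = 0 := fun x => (hker _ (hVW x.2)).2 x.2
  have hle' : lW eW = 1 := hle
  -- The splitting of `W` into `V` and the line through the lattice point `e` of height `1`.
  let Φ : (V × ℝ) ≃ₗ[ℝ] W :=
    LinearEquiv.ofBijective (j.coprod (LinearMap.toSpanSingleton ℝ W eW)) (by
      constructor
      · rw [injective_iff_map_eq_zero]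
        rintro ⟨x, t⟩ h
        rw [LinearMap.coprod_apply, LinearMap.toSpanSingleton_apply] at h
        have h1 := congrArg lW h
        simp only [map_add, map_smul, hlj, hle', map_zero, smul_eq_mul, mul_one, zero_add] at h1
        subst h1
        rw [zero_smul, add_zero] at h
        have h2 : x = 0 := inclusion_injective hVW (by rw [map_zero]; exact h)
        rw [h2]; rfl
      · intro y
        have hmem : (y : Fin n → ℝ) - l y • intCast n e ∈ V := by
          refine (hker _ (W.sub_mem y.2 (W.smul_mem _ he))).1 ?_
          simp [hle]
        refine ⟨(⟨_, hmem⟩, l y), ?_⟩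
        apply Subtype.ext
        simp [j, eW])
  have hΦ : ∀ x, Φ x = j x.1 + x.2 • eW := fun x => rfl
  obtain ⟨K, hK⟩ := exists_measure_pyramid_eq (Measure.addHaar : Measure V)
    (Measure.addHaar : Measure W) Φ
  have hpyr : ∀ S : Set V, Convex ℝ S → IsCompact S → S.Nonempty →
      (Measure.addHaar : Measure W).real (convexHull ℝ (insert eW (j '' S))) =
        K.toReal * (Measure.addHaar : Measure V).real S := by
    intro S h1 h2 h3
    rw [measureReal_def, measureReal_def, ← ENNReal.toReal_mul, ← hK S h1 h2 h3]
    congr 2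
    have := Φ.toLinearMap.image_convexHull (insert (0, 1) (S ×ˢ {(0 : ℝ)}))
    rw [LinearEquiv.coe_coe] at this
    rw [this, Set.image_insert_eq]
    congr 2
    · simp [hΦ]
    · ext y
      simp [hΦ]
  -- This map fixes `V` pointwise and takes `e` to `p`; its determinant is `l p`. It may be
  -- singular, which covers `p ∈ V`.
  let A : W →ₗ[ℝ] W := LinearMap.transvection lW (pW - eW)
  have hA : ∀ S : Set V, convexHull ℝ (insert pW (j '' S)) =
      A '' convexHull ℝ (insert eW (j '' S)) := by
    intro S
    rw [LinearMap.image_convexHull, Set.image_insert_eq, Set.image_image]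
    have h1 : A eW = pW := by simp [A, LinearMap.transvection.apply, hle']
    have h2 : ∀ x, A (j x) = j x := fun x => by simp [A, LinearMap.transvection.apply, hlj]
    simp only [h1, h2]
  have hdet : LinearMap.det A = l p := by
    rw [LinearMap.transvection.det, map_sub, hle']
    simp [lW, pW]
  let BV : Set V := {x | (x : Fin n → ℝ) ∈ B}
  have hBVc : IsCompact BV :=
    (closed_of_finiteDimensional V).isClosedEmbedding_subtypeVal.isCompact_preimage hBc
  have hBVconv : Convex ℝ BV := hB.linear_preimage V.subtype
  have hBVne : BV.Nonempty := by
    obtain ⟨x, hx⟩ := hne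
    exact ⟨⟨x, hBV hx⟩, hx⟩
  have hset : {y : W | (y : Fin n → ℝ) ∈ convexHull ℝ (insert p B)} =
      convexHull ℝ (insert pW (j '' BV)) := by
    have hBeq : (fun x : V => ((j x : W) : Fin n → ℝ)) '' BV = B := by
      ext y
      constructor
      · rintro ⟨x, hx, rfl⟩
        exact hx
      · exact fun hy => ⟨⟨y, hBV hy⟩, hy, rfl⟩
    rw [← preimage_coe_convexHull, Set.image_insert_eq, Set.image_image, hBeq]
  -- The unimodular simplex of `W` is a pyramid with apex `e` over that of `V`, so `K` is the ratio
  -- of the two normalizations and cancels at the end.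
  have hsimp : (Measure.addHaar : Measure W).real (unimodularSimplex W) =
      K.toReal * (Measure.addHaar : Measure V).real (unimodularSimplex V) := by
    rw [← measure_simplex_eq hW
      (latticeConsBasis hVW hint hker he hle (finBasis ℤ (lattice V))),
      range_realBasis_latticeConsBasis hV, unimodularSimplex_eq hV, ← hpyr]
    · congr 1
      rw [LinearMap.image_convexHull, convexHull_insert_convexHull, Set.image_insert_eq,
        map_zero, Set.insert_comm]
    · exact convex_convexHull ℝ _
    · exact ((Set.finite_range _).insert 0).isCompact_convexHull ℝ
    · exact ⟨0, subset_convexHull ℝ _ (Or.inl rfl)⟩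
  have hKpos : K.toReal ≠ 0 := by
    intro h
    have := measure_unimodularSimplex_pos hW Measure.addHaar
    rw [hsimp, h, zero_mul] at this
    exact this.false
  rw [relVol, relVol, hset, hA, measureReal_def, Measure.addHaar_image_linearMap,
    ENNReal.toReal_mul, hdet, ENNReal.toReal_ofReal (abs_nonneg _), ← measureReal_def,
    hpyr BV hBVconv hBVc hBVne, hsimp, mul_div_assoc, mul_div_mul_left _ _ hKpos]

end

/-! ### Cones, their cross-sections and separation by facets. -/

section

variable {n m : ℕ}

/-- A point `x ≠ 0` of `D` with `L x ≤ 1` lies between `0` and `(L x)⁻¹ • x`. The set `D` will be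
the cone or one of its faces. -/
theorem bar_levelSet_eq {D : Set (Fin n → ℝ)} (h0 : 0 ∈ D) (hconv : Convex ℝ D)
    (hsmul : ∀ t : ℝ, 0 ≤ t → ∀ x ∈ D, t • x ∈ D) {L : (Fin n → ℝ) →ₗ[ℝ] ℝ}
    (hL : ∀ x ∈ D, x ≠ 0 → 0 < L x) :
    bar {x | x ∈ D ∧ L x = 1} = {x | x ∈ D ∧ L x ≤ 1} := by
  apply Set.Subset.antisymm
  · refine convexHull_min (Set.insert_subset ⟨h0, by simp⟩ fun x hx => ⟨hx.1, hx.2.le⟩) ?_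
    exact hconv.inter (convex_halfSpace_le L.isLinear 1)
  · rintro x ⟨hx, hx1⟩
    have hz : (0 : Fin n → ℝ) ∈ bar {x | x ∈ D ∧ L x = 1} := subset_convexHull ℝ _ (Or.inl rfl)
    by_cases hx0 : x = 0
    · rwa [hx0]
    have hpos := hL x hx hx0
    have hmem : (L x)⁻¹ • x ∈ bar {x | x ∈ D ∧ L x = 1} := by
      refine subset_convexHull ℝ _ (Or.inr ⟨hsmul _ (inv_nonneg.2 hpos.le) x hx, ?_⟩)
      rw [map_smul, smul_eq_mul, inv_mul_cancel₀ hpos.ne']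
    have := (convex_convexHull ℝ _).smul_mem_of_zero_mem hz hmem ⟨hpos.le, hx1⟩
    rwa [smul_inv_smul₀ hpos.ne'] at this

theorem span_levelSet_eq {D : Set (Fin n → ℝ)}
    (hsmul : ∀ t : ℝ, 0 ≤ t → ∀ x ∈ D, t • x ∈ D) {L : (Fin n → ℝ) →ₗ[ℝ] ℝ}
    (hL : ∀ x ∈ D, x ≠ 0 → 0 < L x) :
    span ℝ {x | x ∈ D ∧ L x = 1} = span ℝ D := by
  refine le_antisymm (span_mono fun x hx => hx.1) (span_le.2 fun x hx => ?_)
  by_cases hx0 : x = 0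
  · rw [hx0]; exact zero_mem _
  have hpos := hL x hx hx0
  have hmem : (L x)⁻¹ • x ∈ span ℝ {x | x ∈ D ∧ L x = 1} := by
    refine subset_span ⟨hsmul _ (inv_nonneg.2 hpos.le) x hx, ?_⟩
    rw [map_smul, smul_eq_mul, inv_mul_cancel₀ hpos.ne']
  have := smul_mem _ (L x) hmem
  rwa [smul_inv_smul₀ hpos.ne'] at this

theorem zero_mem_bar (X : Set (Fin n → ℝ)) : (0 : Fin n → ℝ) ∈ bar X :=
  subset_convexHull ℝ _ (Or.inl rfl)

theorem subset_bar (X : Set (Fin n → ℝ)) : X ⊆ bar X :=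
  fun _ hx => subset_convexHull ℝ _ (Or.inr hx)

theorem span_bar (X : Set (Fin n → ℝ)) : span ℝ (bar X) = span ℝ X := by
  refine le_antisymm (span_le.2 ?_) (span_mono (subset_bar X))
  exact convexHull_min (Set.insert_subset (zero_mem _) subset_span) (span ℝ X).convex

theorem affineSpan_bar (X : Set (Fin n → ℝ)) :
    affineSpan ℝ (bar X) = (span ℝ X).toAffineSubspace := by
  rw [affineSpan_eq_span (zero_mem_bar X), span_bar]

/-- The dimension of a set on which a linear form is constantly `1`. -/
theorem dim_add_one {X : Set (Fin n → ℝ)} (hX : X.Nonempty) {L : (Fin n → ℝ) →ₗ[ℝ] ℝ}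
    (hL : ∀ x ∈ X, L x = 1) : dim X + 1 = finrank ℝ (span ℝ X) := by
  obtain ⟨x₀, hx₀⟩ := hX
  rw [dim, direction_affineSpan]
  set V := vectorSpan ℝ X with hV
  set W := span ℝ X with hW
  have hVW : V ≤ W := by
    rw [hV, vectorSpan_def, span_le]
    rintro _ ⟨x, hx, y, hy, rfl⟩
    exact sub_mem (subset_span hx) (subset_span hy)
  have hLV : ∀ y ∈ V, L y = 0 := by
    have : V ≤ LinearMap.ker L := by
      rw [hV, vectorSpan_def, span_le]
      rintro _ ⟨x, hx, y, hy, rfl⟩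
      simp [hL x hx, hL y hy]
    exact fun y hy => this hy
  have hWV : ∀ y ∈ W, y - L y • x₀ ∈ V := by
    have : W ≤ V.comap (LinearMap.id - L.smulRight x₀) := by
      rw [hW, span_le]
      intro x hx
      have := vsub_mem_vectorSpan ℝ hx hx₀
      simpa [hL x hx] using this
    exact fun y hy => this hy
  have hker : LinearMap.ker (L ∘ₗ W.subtype) = V.submoduleOf W := by
    ext y
    rw [LinearMap.mem_ker, LinearMap.comp_apply, subtype_apply]
    change _ ↔ (y : Fin n → ℝ) ∈ V
    refine ⟨fun h => ?_, hLV _⟩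
    simpa [h] using hWV y y.2
  have hrange : LinearMap.range (L ∘ₗ W.subtype) = ⊤ := by
    rw [LinearMap.range_eq_top]
    intro t
    exact ⟨t • ⟨x₀, subset_span hx₀⟩, by simp [hL x₀ hx₀]⟩
  have h := (L ∘ₗ W.subtype).finrank_range_add_finrank_ker
  rw [hrange, finrank_top, finrank_self, hker, (submoduleOfEquivOfLe hVW).finrank_eq] at h
  omega

section Cone

variable {v : Fin m → Fin n → ℤ}

theorem zero_mem_cone : (0 : Fin n → ℝ) ∈ cone v := ⟨0, by simp, by simp⟩

theorem smul_mem_cone {t : ℝ} (ht : 0 ≤ t) {x : Fin n → ℝ} (hx : x ∈ cone v) : t • x ∈ cone v := by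
  obtain ⟨c, hc, rfl⟩ := hx
  exact ⟨fun i => t * c i, fun i => mul_nonneg ht (hc i), by simp [Finset.smul_sum, mul_smul]⟩

theorem add_mem_cone {x y : Fin n → ℝ} (hx : x ∈ cone v) (hy : y ∈ cone v) : x + y ∈ cone v := by
  obtain ⟨c, hc, rfl⟩ := hx
  obtain ⟨c', hc', rfl⟩ := hy
  exact ⟨fun i => c i + c' i, fun i => add_nonneg (hc i) (hc' i), by
    simp [Finset.sum_add_distrib, add_smul]⟩

theorem intCast_mem_cone (i : Fin m) : intCast n (v i) ∈ cone v := by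
  classical
  refine ⟨Pi.single i 1, fun j => ?_, ?_⟩
  · by_cases h : j = i
    · subst h; simp
    · simp [h]
  · rw [Finset.sum_eq_single i] <;> simp +contextual

theorem convex_cone : Convex ℝ (cone v) := fun _ hx _ hy _ _ ha hb _ =>
  add_mem_cone (smul_mem_cone ha hx) (smul_mem_cone hb hy)

theorem nonneg_on_cone {l : (Fin n → ℝ) →ₗ[ℝ] ℝ} (hl : ∀ i, 0 ≤ l (intCast n (v i)))
    {x : Fin n → ℝ} (hx : x ∈ cone v) : 0 ≤ l x := by
  obtain ⟨c, hc, rfl⟩ := hx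
  simp only [map_sum, map_smul, smul_eq_mul]
  exact Finset.sum_nonneg fun i _ => mul_nonneg (hc i) (hl i)

/-- The linear hull of the face of a cone that is cut out by a supporting form. -/
theorem span_face_eq {l : (Fin n → ℝ) →ₗ[ℝ] ℝ} (hl : ∀ i, 0 ≤ l (intCast n (v i))) :
    span ℝ {x | x ∈ cone v ∧ l x = 0} =
      span ℝ (intCast n '' (v '' {i | l (intCast n (v i)) = 0})) := by
  apply le_antisymm
  · rw [span_le]
    rintro x ⟨⟨c, hc, rfl⟩, hx⟩
    simp only [map_sum, map_smul, smul_eq_mul] at hx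
    rw [Finset.sum_eq_zero_iff_of_nonneg fun i _ => mul_nonneg (hc i) (hl i)] at hx
    refine sum_mem fun i hi => ?_
    rcases mul_eq_zero.1 (hx i hi) with h | h
    · rw [h, zero_smul]; exact zero_mem _
    · exact smul_mem _ _ (subset_span ⟨_, ⟨i, h, rfl⟩, rfl⟩)
  · refine span_mono ?_
    rintro _ ⟨_, ⟨i, hi, rfl⟩, rfl⟩
    exact ⟨intCast_mem_cone i, hi⟩

theorem span_cone_eq : span ℝ (cone v) = span ℝ (intCast n '' (v '' Set.univ)) := by
  simpa using span_face_eq (v := v) (l := 0) (fun i => le_rfl)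

theorem isRational_span_cone : IsRational (span ℝ (cone v)) := by
  rw [span_cone_eq]
  exact isRational_span _

variable {δ : (Fin n → ℤ) →ₗ[ℤ] ℤ}

theorem bar_face_eq (hpos : ∀ x ∈ cone v, x ≠ 0 → 0 < realForm δ x) (l : (Fin n → ℝ) →ₗ[ℝ] ℝ) :
    bar {x | x ∈ crossSection (cone v) δ ∧ l x = 0} =
      {x | (x ∈ cone v ∧ l x = 0) ∧ realForm δ x ≤ 1} := by
  have h : {x | x ∈ crossSection (cone v) δ ∧ l x = 0} =
      {x | x ∈ {x | x ∈ cone v ∧ l x = 0} ∧ realForm δ x = 1} := by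
    ext x
    simp only [crossSection, Set.mem_ofPred_eq]
    tauto
  rw [h]
  refine bar_levelSet_eq (D := {x | x ∈ cone v ∧ l x = 0}) ⟨zero_mem_cone, map_zero l⟩ ?_ ?_
    fun x hx => hpos x hx.1
  · exact convex_cone.inter (convex_hyperplane l.isLinear 0)
  · exact fun t ht x hx => ⟨smul_mem_cone ht hx.1, by rw [map_smul, hx.2, smul_zero]⟩

theorem span_face_crossSection_eq (hpos : ∀ x ∈ cone v, x ≠ 0 → 0 < realForm δ x)
    (l : (Fin n → ℝ) →ₗ[ℝ] ℝ) :
    span ℝ {x | x ∈ crossSection (cone v) δ ∧ l x = 0} =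
      span ℝ {x | x ∈ cone v ∧ l x = 0} := by
  have h : {x | x ∈ crossSection (cone v) δ ∧ l x = 0} =
      {x | x ∈ {x | x ∈ cone v ∧ l x = 0} ∧ realForm δ x = 1} := by
    ext x
    simp only [crossSection, Set.mem_ofPred_eq]
    tauto
  rw [h]
  refine span_levelSet_eq ?_ fun x hx => hpos x hx.1
  exact fun t ht x hx => ⟨smul_mem_cone ht hx.1, by rw [map_smul, hx.2, smul_zero]⟩

theorem bar_crossSection_eq (hpos : ∀ x ∈ cone v, x ≠ 0 → 0 < realForm δ x) :
    bar (crossSection (cone v) δ) = {x | x ∈ cone v ∧ realForm δ x ≤ 1} := by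
  simpa using bar_face_eq hpos 0

theorem span_crossSection_eq (hpos : ∀ x ∈ cone v, x ≠ 0 → 0 < realForm δ x) :
    span ℝ (crossSection (cone v) δ) = span ℝ (cone v) := by
  simpa using span_face_crossSection_eq hpos 0

/-- The generators of the cone, normalized to `δ = 1`, together with `0` span `bar P`. -/
theorem bar_crossSection_eq_convexHull (hpos : ∀ x ∈ cone v, x ≠ 0 → 0 < realForm δ x) :
    bar (crossSection (cone v) δ) =
      convexHull ℝ (insert 0 (Set.range fun i => ((δ (v i) : ℝ))⁻¹ • intCast n (v i))) := by
  have hδ : ∀ i, 0 ≤ (δ (v i) : ℝ) := fun i => by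
    by_cases h : intCast n (v i) = 0
    · rw [← realForm_intCast, h, map_zero]
    · rw [← realForm_intCast]
      exact (hpos _ (intCast_mem_cone i) h).le
  rw [bar_crossSection_eq hpos]
  apply Set.Subset.antisymm
  · rintro x ⟨⟨c, hc, rfl⟩, hx⟩
    simp only [map_sum, map_smul, realForm_intCast, smul_eq_mul] at hx
    set K := convexHull ℝ (insert 0 (Set.range fun i => ((δ (v i) : ℝ))⁻¹ • intCast n (v i)))
    have h0 : (0 : Fin n → ℝ) ∈ K := subset_convexHull ℝ _ (Or.inl rfl)
    -- The index `none` gives the vertex `0` the remaining weight `1 - δ(x)`. Zero generators are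
    -- harmless, as their points are `0` too.
    let w : Option (Fin m) → ℝ := fun o => o.elim (1 - ∑ i, c i * δ (v i)) fun i => c i * δ (v i)
    let z : Option (Fin m) → Fin n → ℝ :=
      fun o => o.elim 0 fun i => ((δ (v i) : ℝ))⁻¹ • intCast n (v i)
    have := (convex_convexHull ℝ (insert 0 (Set.range fun i =>
      ((δ (v i) : ℝ))⁻¹ • intCast n (v i)))).sum_mem (t := Finset.univ) (w := w) (z := z)
      (by
        rintro (_ | i) -
        · exact sub_nonneg.2 hx
        · exact mul_nonneg (hc i) (hδ i))
      (by simp [w, Fintype.sum_option])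
      (by
        rintro (_ | i) -
        · exact h0
        · exact subset_convexHull ℝ _ (Or.inr ⟨i, rfl⟩))
    rw [Fintype.sum_option] at this
    simp only [w, z, Option.elim, smul_zero, zero_add] at this
    convert this using 2 with i
    by_cases h : intCast n (v i) = 0
    · simp [h]
    · have h1 := hpos _ (intCast_mem_cone i) h
      rw [realForm_intCast] at h1
      rw [smul_smul, mul_assoc, mul_inv_cancel₀ h1.ne', mul_one]
  · refine convexHull_min (Set.insert_subset ⟨zero_mem_cone, by simp⟩ ?_) ?_
    · rintro _ ⟨i, rfl⟩
      refine ⟨smul_mem_cone (inv_nonneg.2 (hδ i)) (intCast_mem_cone i), ?_⟩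
      rw [map_smul, realForm_intCast, smul_eq_mul]
      exact inv_mul_le_one
    · exact convex_cone.inter (convex_halfSpace_le (realForm δ).isLinear 1)

theorem isCompact_bar_crossSection (hpos : ∀ x ∈ cone v, x ≠ 0 → 0 < realForm δ x) :
    IsCompact (bar (crossSection (cone v) δ)) := by
  rw [bar_crossSection_eq_convexHull hpos]
  exact ((Set.finite_range _).insert 0).isCompact_convexHull ℝ

/-- Near any point the cone is contained in a multiple of the compact set `bar P`, which in turn
lies in the cone. -/
theorem isClosed_cone (hpos : ∀ x ∈ cone v, x ≠ 0 → 0 < realForm δ x) : IsClosed (cone v) := by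
  have hcont : Continuous (realForm δ) := LinearMap.continuous_of_finiteDimensional _
  rw [← closure_subset_iff_isClosed]
  intro x hx
  set N : ℝ := max (realForm δ x + 1) 1
  have hN : 0 < N := lt_of_lt_of_le one_pos (le_max_right _ _)
  have hopen : IsOpen {y | realForm δ y < N} := isOpen_lt hcont continuous_const
  have hxN : x ∈ {y | realForm δ y < N} :=
    show realForm δ x < N from lt_of_lt_of_le (lt_add_one _) (le_max_left _ _)
  have hsub : cone v ∩ {y | realForm δ y < N} ⊆
      (fun y => N • y) '' bar (crossSection (cone v) δ) := by
    rintro y ⟨hy, hyN⟩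
    refine ⟨N⁻¹ • y, ?_, smul_inv_smul₀ hN.ne' y⟩
    rw [bar_crossSection_eq hpos]
    refine ⟨smul_mem_cone (inv_nonneg.2 hN.le) hy, ?_⟩
    rw [map_smul, smul_eq_mul, inv_mul_le_iff₀ hN, mul_one]
    exact le_of_lt hyN
  have hcl : IsClosed ((fun y : Fin n → ℝ => N • y) '' bar (crossSection (cone v) δ)) :=
    ((isCompact_bar_crossSection hpos).image (continuous_const_smul N)).isClosed
  have h1 : x ∈ closure (cone v ∩ {y | realForm δ y < N}) := by
    rw [Set.inter_comm]
    exact hopen.inter_closure ⟨hxN, hx⟩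
  obtain ⟨y, hy, hyx⟩ := closure_minimal hsub hcl h1
  rw [bar_crossSection_eq hpos] at hy
  rw [← hyx]
  exact smul_mem_cone hN.le hy.1

/-- Separation of a point from a closed cone. -/
theorem exists_separating_form (hpos : ∀ x ∈ cone v, x ≠ 0 → 0 < realForm δ x)
    {y : Fin n → ℝ} (hy : y ∉ cone v) :
    ∃ l : (Fin n → ℝ) →ₗ[ℝ] ℝ, (∀ i, 0 ≤ l (intCast n (v i))) ∧ l y < 0 := by
  obtain ⟨f, u, hfy, hfu⟩ := geometric_hahn_banach_point_closed convex_cone (isClosed_cone hpos) hy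
  have hu : u < 0 := by simpa using hfu 0 zero_mem_cone
  refine ⟨f.toLinearMap, fun i => ?_, hfy.trans hu⟩
  -- If `f` were negative on a generator, a nonnegative multiple of that generator would have value
  -- exactly `u`, contrary to strict separation.
  by_contra! h
  have h1 : f (intCast n (v i)) < 0 := h
  have h2 := hfu _ (smul_mem_cone (t := u / f (intCast n (v i)))
    (div_nonneg_of_nonpos hu.le h1.le) (intCast_mem_cone i))
  rw [map_smul, smul_eq_mul, div_mul_cancel₀ _ h1.ne] at h2
  exact h2.false

/-- Tilt `l` by a form `μ` that vanishes on the face and at `y`, until the first further generator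
gets the value `0`. Such a `μ`, negative on some generator, exists because the face has codimension
at least two, so that the face and `y` do not span all generators. -/
theorem exists_larger_face {l : (Fin n → ℝ) →ₗ[ℝ] ℝ} (hl : ∀ i, 0 ≤ l (intCast n (v i)))
    {y : Fin n → ℝ} (hly : l y < 0)
    (hlt : finrank ℝ (span ℝ {x | x ∈ cone v ∧ l x = 0}) + 1 < finrank ℝ (span ℝ (cone v))) :
    ∃ l' : (Fin n → ℝ) →ₗ[ℝ] ℝ, (∀ i, 0 ≤ l' (intCast n (v i))) ∧ l' y < 0 ∧
      finrank ℝ (span ℝ {x | x ∈ cone v ∧ l x = 0}) <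
        finrank ℝ (span ℝ {x | x ∈ cone v ∧ l' x = 0}) := by
  classical
  set Z := span ℝ {x | x ∈ cone v ∧ l x = 0} with hZ
  have hZ' : finrank ℝ (Z ⊔ ℝ ∙ y : Submodule ℝ (Fin n → ℝ)) < finrank ℝ (span ℝ (cone v)) :=
    lt_of_le_of_lt ((finrank_add_le_finrank_add_finrank _ _).trans
      (Nat.add_le_add_left ((finrank_span_le_card ({y} : Set (Fin n → ℝ))).trans (by simp)) _)) hlt
  obtain ⟨i₀, hi₀⟩ : ∃ i, intCast n (v i) ∉ Z ⊔ ℝ ∙ y := by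
    by_contra! h
    refine absurd (finrank_mono (R := ℝ) (s := span ℝ (cone v)) (t := Z ⊔ ℝ ∙ y) ?_) hZ'.not_ge
    rw [span_cone_eq, span_le]
    rintro _ ⟨_, ⟨i, -, rfl⟩, rfl⟩
    exact h i
  obtain ⟨μ, hμ₀, hμ⟩ : ∃ μ : (Fin n → ℝ) →ₗ[ℝ] ℝ, μ (intCast n (v i₀)) < 0 ∧
      ∀ z ∈ Z ⊔ ℝ ∙ y, μ z = 0 := by
    obtain ⟨f, hf, hle⟩ := exists_le_ker_of_notMem hi₀
    rcases lt_or_gt_of_ne hf with h | h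
    · exact ⟨f, h, fun z hz => hle hz⟩
    · exact ⟨-f, by simpa using h, fun z hz => by simpa using hle hz⟩
  have hμy : μ y = 0 := hμ y (mem_sup_right (mem_span_singleton_self y))
  have hμZ : ∀ z ∈ Z, μ z = 0 := fun z hz => hμ z (mem_sup_left hz)
  obtain ⟨i₁, hi₁, hmin⟩ := (Finset.univ.filter fun i => μ (intCast n (v i)) < 0).exists_min_image
    (fun i => l (intCast n (v i)) / -μ (intCast n (v i))) ⟨i₀, by simpa using hμ₀⟩
  simp only [Finset.mem_filter, Finset.mem_univ, true_and] at hi₁ hmin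
  set t := l (intCast n (v i₁)) / -μ (intCast n (v i₁)) with ht
  have ht0 : 0 ≤ t := div_nonneg (hl i₁) (by linarith)
  have hl' : ∀ i, 0 ≤ (l + t • μ) (intCast n (v i)) := by
    intro i
    simp only [LinearMap.add_apply, LinearMap.smul_apply, smul_eq_mul]
    by_cases hi : μ (intCast n (v i)) < 0
    · have := hmin i hi
      rw [le_div_iff₀ (by linarith)] at this
      linarith
    · exact add_nonneg (hl i) (mul_nonneg ht0 (not_lt.1 hi))
  refine ⟨l + t • μ, hl', by simpa [hμy] using hly, finrank_lt_finrank_of_lt ?_⟩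
  have hlZ : ∀ z ∈ Z, l z = 0 := by
    have : Z ≤ LinearMap.ker l := by
      rw [hZ, span_le]
      exact fun x hx => hx.2
    exact fun z hz => this hz
  refine lt_of_le_of_ne (span_mono fun x hx => ⟨hx.1, ?_⟩) fun h => ?_
  · simp [hx.2, hμZ x (subset_span hx)]
  · have hmem : intCast n (v i₁) ∈ Z := by
      rw [h]
      refine subset_span ⟨intCast_mem_cone i₁, ?_⟩
      simp only [LinearMap.add_apply, LinearMap.smul_apply, smul_eq_mul, ht]
      rw [div_mul_eq_mul_div, mul_div_assoc, div_neg, div_self hi₁.ne]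
      ring
    exact hi₁.ne (hμZ _ hmem)

/-- A point of the linear hull of a cone that lies outside of the cone is separated from it by a
facet. -/
theorem exists_separating_facet (hpos : ∀ x ∈ cone v, x ≠ 0 → 0 < realForm δ x)
    {y : Fin n → ℝ} (hy : y ∈ span ℝ (cone v)) (hyC : y ∉ cone v) :
    ∃ l : (Fin n → ℝ) →ₗ[ℝ] ℝ, (∀ i, 0 ≤ l (intCast n (v i))) ∧ l y < 0 ∧
      finrank ℝ (span ℝ {x | x ∈ cone v ∧ l x = 0}) + 1 = finrank ℝ (span ℝ (cone v)) := by
  obtain ⟨l₀, h₀, h₀y⟩ := exists_separating_form hpos hyC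
  -- Here `k` bounds how far the face of the separating form is from being a facet; each tilt lowers
  -- it.
  suffices ∀ (k : ℕ) (l : (Fin n → ℝ) →ₗ[ℝ] ℝ), (∀ i, 0 ≤ l (intCast n (v i))) → l y < 0 →
      finrank ℝ (span ℝ (cone v)) ≤ finrank ℝ (span ℝ {x | x ∈ cone v ∧ l x = 0}) + 1 + k →
      ∃ l : (Fin n → ℝ) →ₗ[ℝ] ℝ, (∀ i, 0 ≤ l (intCast n (v i))) ∧ l y < 0 ∧
      finrank ℝ (span ℝ {x | x ∈ cone v ∧ l x = 0}) + 1 = finrank ℝ (span ℝ (cone v)) from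
    this _ l₀ h₀ h₀y (Nat.le_add_left _ _)
  intro k
  induction k with
  | zero =>
    intro l hl hly hk
    refine ⟨l, hl, hly, le_antisymm (Nat.succ_le_of_lt (finrank_lt_finrank_of_lt ?_)) hk⟩
    refine lt_of_le_of_ne (span_mono fun x hx => hx.1) fun h => ?_
    have : span ℝ {x | x ∈ cone v ∧ l x = 0} ≤ LinearMap.ker l := by
      rw [span_le]
      exact fun x hx => hx.2
    exact hly.ne (this (h ▸ hy))
  | succ k ih =>
    intro l hl hly hk
    by_cases hlt : finrank ℝ (span ℝ {x | x ∈ cone v ∧ l x = 0}) + 1 <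
        finrank ℝ (span ℝ (cone v))
    · obtain ⟨l', hl', hl'y, h⟩ := exists_larger_face hl hly hlt
      exact ih l' hl' hl'y (by omega)
    · exact ih l hl hly (by omega)

end Cone

end

/-! ### Facets, their primitive forms and the decomposition into pyramids. -/

section

variable {n m : ℕ}

theorem isCompact_convexHull_insert {B : Set (Fin n → ℝ)} (hB : Convex ℝ B) (hBc : IsCompact B)
    (hne : B.Nonempty) {p : Fin n → ℝ} : IsCompact (convexHull ℝ (insert p B)) := by
  have himg : convexHull ℝ (insert p B) =
      (fun q : ℝ × (Fin n → ℝ) => (1 - q.1) • p + q.1 • q.2) '' (Set.Icc (0 : ℝ) 1 ×ˢ B) := by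
    rw [convexHull_insert hne, hB.convexHull_eq, convexJoin_singleton_left]
    ext x
    simp only [segment_eq_image, Set.mem_iUnion, Set.mem_image, Set.mem_prod, Prod.exists]
    constructor
    · rintro ⟨b, hb, t, ht, rfl⟩
      exact ⟨t, b, ⟨ht, hb⟩, rfl⟩
    · rintro ⟨t, b, ⟨ht, hb⟩, rfl⟩
      exact ⟨b, hb, t, ht, rfl⟩
  rw [himg]
  exact (isCompact_Icc.prod hBc).image (by fun_prop)

section Facet

variable {v : Fin m → Fin n → ℤ} {δ : (Fin n → ℤ) →ₗ[ℤ] ℤ}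

theorem crossSection_nonempty (hd : 1 ≤ dim (crossSection (cone v) δ)) :
    (crossSection (cone v) δ).Nonempty := by
  by_contra! h
  rw [h, dim, direction_affineSpan, vectorSpan_empty, finrank_bot] at hd
  omega

theorem finrank_span_cone (hpos : ∀ x ∈ cone v, x ≠ 0 → 0 < realForm δ x)
    (hd : 1 ≤ dim (crossSection (cone v) δ)) :
    dim (crossSection (cone v) δ) + 1 = finrank ℝ (span ℝ (cone v)) := by
  rw [dim_add_one (crossSection_nonempty hd) (L := realForm δ) fun x hx => hx.2,
    span_crossSection_eq hpos]

theorem inv_smul_mem_crossSection (hpos : ∀ x ∈ cone v, x ≠ 0 → 0 < realForm δ x)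
    {x : Fin n → ℝ} (hx : x ∈ cone v) (hx0 : x ≠ 0) :
    (realForm δ x)⁻¹ • x ∈ crossSection (cone v) δ := by
  have h := hpos x hx hx0
  exact ⟨smul_mem_cone (inv_nonneg.2 h.le) hx, by
    rw [map_smul, smul_eq_mul, inv_mul_cancel₀ h.ne']⟩

/-- A facet of the cross-section is cut out by a form that is nonnegative on the cone. -/
theorem exists_supporting_form (hpos : ∀ x ∈ cone v, x ≠ 0 → 0 < realForm δ x)
    {F : Set (Fin n → ℝ)} (hF : F ∈ facets (crossSection (cone v) δ)) :
    ∃ l : (Fin n → ℝ) →ₗ[ℝ] ℝ, (∀ i, 0 ≤ l (intCast n (v i))) ∧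
      F = {x | x ∈ crossSection (cone v) δ ∧ l x = 0} := by
  obtain ⟨hne, hexp, -⟩ := hF
  obtain ⟨f, hf⟩ := hexp hne
  obtain ⟨x₀, hx₀⟩ := hne
  have hx₀' : x₀ ∈ crossSection (cone v) δ ∧ ∀ y ∈ crossSection (cone v) δ, f y ≤ f x₀ := by
    rw [hf] at hx₀
    exact hx₀
  -- The maximum `f x₀` is made homogeneous with `δ`, which is `1` on `P`.
  refine ⟨f x₀ • realForm δ - f.toLinearMap, fun i => ?_, ?_⟩
  · by_cases h : intCast n (v i) = 0
    · rw [h, map_zero]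
    have h1 := hx₀'.2 _ (inv_smul_mem_crossSection hpos (intCast_mem_cone i) h)
    rw [map_smul, smul_eq_mul, inv_mul_le_iff₀ (hpos _ (intCast_mem_cone i) h)] at h1
    simp only [LinearMap.sub_apply, LinearMap.smul_apply, smul_eq_mul]
    have h2 : f.toLinearMap (intCast n (v i)) = f (intCast n (v i)) := rfl
    rw [h2]
    linarith
  · rw [hf]
    ext x
    refine and_congr_right fun hx => ?_
    have h2 : f.toLinearMap x = f x := rfl
    have h3 : (f x₀ • realForm δ - f.toLinearMap) x = f x₀ - f x := by
      simp only [LinearMap.sub_apply, LinearMap.smul_apply, smul_eq_mul, hx.2, mul_one, h2]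
    rw [h3, sub_eq_zero]
    exact ⟨fun h => le_antisymm (h _ hx₀'.1) (hx₀'.2 _ hx), fun h y hy => h ▸ hx₀'.2 y hy⟩

theorem finrank_span_facet (hpos : ∀ x ∈ cone v, x ≠ 0 → 0 < realForm δ x)
    (hd : 1 ≤ dim (crossSection (cone v) δ)) {F : Set (Fin n → ℝ)}
    (hF : F ∈ facets (crossSection (cone v) δ)) :
    finrank ℝ (span ℝ F) + 1 = finrank ℝ (span ℝ (cone v)) := by
  rw [← finrank_span_cone hpos hd, ← hF.2.2,
    dim_add_one hF.1 (L := realForm δ) fun x hx => (hF.2.1.subset hx).2]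

theorem facet_subset_cone {F : Set (Fin n → ℝ)} (hF : F ∈ facets (crossSection (cone v) δ)) :
    F ⊆ cone v := fun _ hx => (hF.2.1.subset hx).1

theorem span_facet_le {F : Set (Fin n → ℝ)} (hF : F ∈ facets (crossSection (cone v) δ)) :
    span ℝ F ≤ span ℝ (cone v) := span_mono (facet_subset_cone hF)

theorem mem_facets_of_form (hpos : ∀ x ∈ cone v, x ≠ 0 → 0 < realForm δ x)
    (hd : 1 ≤ dim (crossSection (cone v) δ)) {l : (Fin n → ℝ) →ₗ[ℝ] ℝ}
    (hl : ∀ i, 0 ≤ l (intCast n (v i)))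
    (hfin : finrank ℝ (span ℝ {x | x ∈ cone v ∧ l x = 0}) + 1 = finrank ℝ (span ℝ (cone v))) :
    {x | x ∈ crossSection (cone v) δ ∧ l x = 0} ∈ facets (crossSection (cone v) δ) := by
  have hrk := finrank_span_cone hpos hd
  have hspan := span_face_crossSection_eq hpos l
  have hne : {x | x ∈ crossSection (cone v) δ ∧ l x = 0}.Nonempty := by
    -- An empty face would leave the cone with a hull of dimension one, whereas `d + 1 ≥ 2`.
    by_contra! h
    rw [h, span_empty] at hspan
    rw [← hspan, finrank_bot] at hfin
    omega
  refine ⟨hne, fun _ => ⟨(-l).toContinuousLinearMap, ?_⟩, ?_⟩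
  · ext x
    refine and_congr_right fun hx => ?_
    obtain ⟨y, hy, hly⟩ := hne
    constructor
    · intro h z hz
      have := nonneg_on_cone hl hz.1
      simpa [h] using this
    · intro h
      have := h y hy
      simp only [LinearMap.coe_toContinuousLinearMap', LinearMap.neg_apply, hly] at this
      exact le_antisymm (by linarith) (nonneg_on_cone hl hx.1)
  · have := dim_add_one hne (L := realForm δ) fun x hx => hx.1.2
    rw [hspan] at this
    omega

variable (v δ) in
/-- `l` is the primitive form on the linear hull of the cone that is nonnegative on the cone and
cuts out the facet `F` of the cross-section. -/
structure IsFacetForm (F : Set (Fin n → ℝ)) (l : (Fin n → ℝ) →ₗ[ℝ] ℝ) : Prop where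
  primitive : IsPrimitiveOn l (span ℝ (cone v))
  nonneg : ∀ x ∈ cone v, 0 ≤ l x
  ker : ∀ y ∈ span ℝ (cone v), l y = 0 ↔ y ∈ span ℝ F
  eq : F = {x | x ∈ crossSection (cone v) δ ∧ l x = 0}

theorem isRational_span_facet (hpos : ∀ x ∈ cone v, x ≠ 0 → 0 < realForm δ x)
    {F : Set (Fin n → ℝ)} (hF : F ∈ facets (crossSection (cone v) δ)) :
    IsRational (span ℝ F) := by
  obtain ⟨l, hl, rfl⟩ := exists_supporting_form hpos hF
  rw [span_face_crossSection_eq hpos, span_face_eq hl]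
  exact isRational_span _

/-- A form that vanishes on the kernel of a form `l` is a multiple of `l`. -/
theorem form_eq_mul {V W : Submodule ℝ (Fin n → ℝ)} {l k : (Fin n → ℝ) →ₗ[ℝ] ℝ}
    (hker : ∀ y ∈ W, l y = 0 ↔ y ∈ V) (hk : ∀ y ∈ V, k y = 0) {e : Fin n → ℝ} (he : e ∈ W)
    (hle : l e = 1) {y : Fin n → ℝ} (hy : y ∈ W) : k y = l y * k e := by
  have hmem : y - l y • e ∈ V := by
    refine (hker _ (W.sub_mem hy (W.smul_mem _ he))).1 ?_
    simp [hle]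
  have := hk _ hmem
  rw [map_sub, map_smul, smul_eq_mul] at this
  linarith

theorem form_eq_zero_on_span {l : (Fin n → ℝ) →ₗ[ℝ] ℝ} {s : Set (Fin n → ℝ)}
    (h : ∀ x ∈ s, l x = 0) : ∀ y ∈ span ℝ s, l y = 0 := by
  have : span ℝ s ≤ LinearMap.ker l := span_le.2 h
  exact fun y hy => this hy

theorem exists_isFacetForm (hpos : ∀ x ∈ cone v, x ≠ 0 → 0 < realForm δ x)
    (hd : 1 ≤ dim (crossSection (cone v) δ)) {F : Set (Fin n → ℝ)}
    (hF : F ∈ facets (crossSection (cone v) δ)) : ∃ l, IsFacetForm v δ F l := by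
  have hfin := finrank_span_facet hpos hd hF
  obtain ⟨l, ⟨hint, e, he, hle⟩, hker⟩ := exists_isPrimitiveOn (isRational_span_facet hpos hF)
    isRational_span_cone (span_facet_le hF) hfin
  obtain ⟨k, hk, hFk⟩ := exists_supporting_form hpos hF
  have hkF : ∀ y ∈ span ℝ F, k y = 0 :=
    form_eq_zero_on_span fun x hx => by rw [hFk] at hx; exact hx.2
  have hmul : ∀ y ∈ span ℝ (cone v), k y = l y * k (intCast n e) :=
    fun y hy => form_eq_mul hker hkF he hle hy
  have hke : k (intCast n e) ≠ 0 := by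
    intro h0
    have hFP : F = crossSection (cone v) δ := by
      rw [hFk]
      refine Set.Subset.antisymm (fun x hx => hx.1) fun x hx => ⟨hx, ?_⟩
      rw [hmul x (subset_span hx.1), h0, mul_zero]
    rw [hFP, span_crossSection_eq hpos] at hfin
    omega
  have hkC : ∀ x ∈ cone v, 0 ≤ k x := fun x hx => nonneg_on_cone hk hx
  have hzero : ∀ y ∈ span ℝ (cone v), k y = 0 ↔ l y = 0 := fun y hy => by
    rw [hmul y hy, mul_eq_zero, or_iff_left hke]
  -- The supporting form is `k e` times `l`, so the sign of `k e` tells which of `l` and `-l` is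
  -- nonnegative on the cone.
  rcases lt_or_gt_of_ne hke with h | h
  · refine ⟨-l, ⟨fun z hz => ?_, -e, neg_mem he, by simp [hle]⟩, fun x hx => ?_, fun y hy => ?_, ?_⟩
    · obtain ⟨j, hj⟩ := hint z hz
      exact ⟨-j, by simp [hj]⟩
    · have := hkC x hx
      rw [hmul x (subset_span hx)] at this
      rw [LinearMap.neg_apply, neg_nonneg]
      exact nonpos_of_mul_nonneg_left this h
    · rw [LinearMap.neg_apply, neg_eq_zero, hker y hy]
    · rw [hFk]
      ext x
      refine and_congr_right fun hx => ?_
      rw [LinearMap.neg_apply, neg_eq_zero, hzero x (subset_span hx.1)]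
  · refine ⟨l, ⟨hint, e, he, hle⟩, fun x hx => ?_, hker, ?_⟩
    · have := hkC x hx
      rw [hmul x (subset_span hx)] at this
      exact nonneg_of_mul_nonneg_left this h
    · rw [hFk]
      ext x
      refine and_congr_right fun hx => ?_
      rw [hzero x (subset_span hx.1)]

/-- A facet is determined by the set of generators on which a supporting form vanishes. -/
theorem finite_facets (hpos : ∀ x ∈ cone v, x ≠ 0 → 0 < realForm δ x) :
    (facets (crossSection (cone v) δ)).Finite := by
  refine (Set.finite_range fun s : Set (Fin m) =>
    crossSection (cone v) δ ∩ (span ℝ (intCast n '' (v '' s)) : Set (Fin n → ℝ))).subset ?_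
  intro F hF
  obtain ⟨l, hl, hFl⟩ := exists_supporting_form hpos hF
  refine ⟨{i | l (intCast n (v i)) = 0}, ?_⟩
  dsimp only
  rw [← span_face_eq hl, ← span_face_crossSection_eq hpos, ← hFl]
  refine Set.Subset.antisymm (fun x hx => ?_) fun x hx => ⟨hF.2.1.subset hx, subset_span hx⟩
  rw [hFl]
  refine ⟨hx.1, form_eq_zero_on_span (fun y hy => ?_) x hx.2⟩
  rw [hFl] at hy
  exact hy.2

/-- A polyhedral cone is cut out from its linear hull by the forms of its facets. -/
theorem mem_cone_of_facetForms (hpos : ∀ x ∈ cone v, x ≠ 0 → 0 < realForm δ x)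
    (hd : 1 ≤ dim (crossSection (cone v) δ)) {l : Set (Fin n → ℝ) → (Fin n → ℝ) →ₗ[ℝ] ℝ}
    (hl : ∀ F ∈ facets (crossSection (cone v) δ), IsFacetForm v δ F (l F)) {y : Fin n → ℝ}
    (hy : y ∈ span ℝ (cone v)) (hly : ∀ F ∈ facets (crossSection (cone v) δ), 0 ≤ l F y) :
    y ∈ cone v := by
  by_contra hyC
  -- The separating form `k` is a nonnegative multiple of the form of its facet, so it cannot be
  -- negative at `y`.
  obtain ⟨k, hk, hky, hfin⟩ := exists_separating_facet hpos hy hyC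
  have hF := mem_facets_of_form hpos hd hk hfin
  set F := {x | x ∈ crossSection (cone v) δ ∧ k x = 0} with hFk
  obtain ⟨⟨-, e, he, hle⟩, hnn, hker, -⟩ := hl F hF
  have hmul : ∀ y ∈ span ℝ (cone v), k y = l F y * k (intCast n e) := fun y hy =>
    form_eq_mul hker (form_eq_zero_on_span fun x hx => hx.2) he hle hy
  obtain ⟨x, hx, hlx⟩ : ∃ x ∈ cone v, 0 < l F x := by
    by_contra! h
    have := form_eq_zero_on_span (fun x hx => le_antisymm (h x hx) (hnn x hx)) _ he
    rw [hle] at this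
    exact one_ne_zero this
  have h1 := nonneg_on_cone hk hx
  rw [hmul x (subset_span hx)] at h1
  have h2 := nonneg_of_mul_nonneg_right h1 hlx
  have h3 := hmul y hy
  have h4 := mul_nonneg (hly F hF) h2
  linarith

theorem height_bar_facet (hpos : ∀ x ∈ cone v, x ≠ 0 → 0 < realForm δ x)
    (hd : 1 ≤ dim (crossSection (cone v) δ)) {F : Set (Fin n → ℝ)}
    (hF : F ∈ facets (crossSection (cone v) δ)) {l : (Fin n → ℝ) →ₗ[ℝ] ℝ}
    (hl : IsPrimitiveOn l (span ℝ (cone v)))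
    (hker : ∀ y ∈ span ℝ (cone v), l y = 0 ↔ y ∈ span ℝ F) {x : Fin n → ℝ} (hx : x ∈ cone v) :
    height (bar F) x = |l x| := by
  rw [height, affineSpan_bar]
  exact heightOver_eq (span_facet_le hF) (finrank_span_facet hpos hd hF) hl hker (subset_span hx)

namespace IsFacetForm

variable {F G : Set (Fin n → ℝ)} {l k : (Fin n → ℝ) →ₗ[ℝ] ℝ}

theorem bar_eq (h : IsFacetForm v δ F l) (hpos : ∀ x ∈ cone v, x ≠ 0 → 0 < realForm δ x) :
    bar F = {x | (x ∈ cone v ∧ l x = 0) ∧ realForm δ x ≤ 1} := by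
  conv_lhs => rw [h.eq]
  exact bar_face_eq hpos l

theorem isCompact_bar (h : IsFacetForm v δ F l)
    (hpos : ∀ x ∈ cone v, x ≠ 0 → 0 < realForm δ x) : IsCompact (bar F) := by
  have hcont : Continuous l := LinearMap.continuous_of_finiteDimensional _
  have : bar F = bar (crossSection (cone v) δ) ∩ {x | l x = 0} := by
    rw [h.bar_eq hpos, bar_crossSection_eq hpos]
    ext x
    simp only [Set.mem_ofPred_eq, Set.mem_inter_iff]
    tauto
  rw [this]
  exact (isCompact_bar_crossSection hpos).inter_right (isClosed_eq hcont continuous_const)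

theorem relVol_pyramid (h : IsFacetForm v δ F l)
    (hpos : ∀ x ∈ cone v, x ≠ 0 → 0 < realForm δ x)
    (hF : F ∈ facets (crossSection (cone v) δ)) {p : Fin n → ℝ} (hp : p ∈ cone v) :
    relVol (span ℝ (cone v)) (convexHull ℝ (insert p (bar F))) = l p * vol (bar F) := by
  have hconv : Convex ℝ (bar F) := convex_convexHull ℝ _
  rw [LatticeVolume.relVol_pyramid (isRational_span_facet hpos hF) isRational_span_cone
    (span_facet_le hF) h.primitive h.ker ?_ hconv (h.isCompact_bar hpos)
    ⟨0, zero_mem_bar F⟩ (subset_span hp), abs_of_nonneg (h.nonneg p hp),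
    vol_eq_relVol (zero_mem_bar F), span_bar]
  rw [← span_bar]
  exact subset_span

theorem exists_of_mem_pyramid (h : IsFacetForm v δ F l)
    (hpos : ∀ x ∈ cone v, x ≠ 0 → 0 < realForm δ x) {p x : Fin n → ℝ}
    (hx : x ∈ convexHull ℝ (insert p (bar F))) :
    ∃ s : ℝ, 0 ≤ s ∧ ∃ z ∈ cone v, l z = 0 ∧ x = z + s • p := by
  have hconv : Convex ℝ (bar F) := convex_convexHull ℝ _
  rw [convexHull_insert ⟨0, zero_mem_bar F⟩, hconv.convexHull_eq, convexJoin_singleton_left,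
    Set.mem_iUnion₂] at hx
  obtain ⟨b, hb, s, r, hs, hr, -, rfl⟩ := hx
  rw [h.bar_eq hpos] at hb
  exact ⟨s, hs, r • b, smul_mem_cone hr hb.1.1, by rw [map_smul, hb.1.2, smul_zero], add_comm _ _⟩

/-- The pyramid over a facet `F` consists of points where the quotient of `l` by `l p` is at most
the respective quotient of any other form that is nonnegative on the cone. -/
theorem mul_le_mul_of_mem_pyramid (h : IsFacetForm v δ F l)
    (hpos : ∀ x ∈ cone v, x ≠ 0 → 0 < realForm δ x) {p x : Fin n → ℝ} (hp : p ∈ cone v)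
    (hk : ∀ x ∈ cone v, 0 ≤ k x) (hx : x ∈ convexHull ℝ (insert p (bar F))) :
    l x * k p ≤ l p * k x := by
  obtain ⟨s, hs, z, hz, hlz, rfl⟩ := h.exists_of_mem_pyramid hpos hx
  simp only [map_add, map_smul, hlz, smul_eq_mul, zero_add]
  have := mul_nonneg (h.nonneg p hp) (hk z hz)
  linarith

end IsFacetForm

theorem measure_ker_eq_zero {W : Submodule ℝ (Fin n → ℝ)} {l : (Fin n → ℝ) →ₗ[ℝ] ℝ}
    {e : Fin n → ℝ} (he : e ∈ W) (hle : l e ≠ 0) (μ : Measure W) [μ.IsAddHaarMeasure] :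
    μ {y : W | l y = 0} = 0 := by
  refine Measure.addHaar_submodule μ (LinearMap.ker (l ∘ₗ W.subtype)) fun h => hle ?_
  have : (⟨e, he⟩ : W) ∈ LinearMap.ker (l ∘ₗ W.subtype) := h ▸ mem_top
  exact this

/-- On the pyramid over `F` one has `l x * k p ≤ l p * k x`, and the reverse over `G`, so the
intersection lies in the kernel of `l p • k - k p • l`. If `l p = 0`, the first pyramid already lies
in the kernel of `l`. -/
theorem measure_inter_pyramids_eq_zero (hpos : ∀ x ∈ cone v, x ≠ 0 → 0 < realForm δ x)
    {F G : Set (Fin n → ℝ)} {l k : (Fin n → ℝ) →ₗ[ℝ] ℝ} (hl : IsFacetForm v δ F l)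
    (hk : IsFacetForm v δ G k) (hne : F ≠ G) {p : Fin n → ℝ} (hp : p ∈ cone v)
    (μ : Measure (span ℝ (cone v))) [μ.IsAddHaarMeasure] :
    μ ({y | (y : Fin n → ℝ) ∈ convexHull ℝ (insert p (bar F))} ∩
      {y | (y : Fin n → ℝ) ∈ convexHull ℝ (insert p (bar G))}) = 0 := by
  by_cases hlp : l p = 0
  · obtain ⟨-, e, he, hle⟩ := hl.primitive
    refine measure_mono_null ?_ (measure_ker_eq_zero he (by rw [hle]; exact one_ne_zero) μ)
    rintro y ⟨hy, -⟩
    obtain ⟨s, -, z, -, hlz, hyz⟩ := hl.exists_of_mem_pyramid hpos hy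
    change l y = 0
    rw [hyz, map_add, map_smul, hlz, hlp, smul_zero, add_zero]
  -- If this form vanished on the hull, `l` and `k` would have the same zeros on `P`, giving `F =
  -- G`.
  obtain ⟨e, he, hθ⟩ : ∃ e ∈ span ℝ (cone v), (l p • k - k p • l) e ≠ 0 := by
    by_contra! h
    simp only [LinearMap.sub_apply, LinearMap.smul_apply, smul_eq_mul, sub_eq_zero] at h
    have hkp : k p ≠ 0 := by
      intro h0
      obtain ⟨-, e, he, hke⟩ := hk.primitive
      have := h _ he
      rw [hke, h0, zero_mul, mul_one] at this
      exact hlp this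
    refine hne ?_
    rw [hl.eq, hk.eq]
    ext x
    refine and_congr_right fun hx => ?_
    have := h x (subset_span hx.1)
    constructor
    · intro h0
      rw [h0, mul_zero, mul_eq_zero] at this
      exact this.resolve_left hlp
    · intro h0
      rw [h0, mul_zero, eq_comm, mul_eq_zero] at this
      exact this.resolve_left hkp
  refine measure_mono_null ?_ (measure_ker_eq_zero he hθ μ)
  rintro y ⟨hyF, hyG⟩
  have h1 := hl.mul_le_mul_of_mem_pyramid hpos hp hk.nonneg hyF
  have h2 := hk.mul_le_mul_of_mem_pyramid hpos hp hl.nonneg hyG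
  change (l p • k - k p • l) y = 0
  simp only [LinearMap.sub_apply, LinearMap.smul_apply, smul_eq_mul]
  linarith

/-- The pyramids with a common apex `p ∈ P` over the facets of `P` cover `P`. -/
theorem bar_crossSection_eq_biUnion (hpos : ∀ x ∈ cone v, x ≠ 0 → 0 < realForm δ x)
    (hd : 1 ≤ dim (crossSection (cone v) δ)) {l : Set (Fin n → ℝ) → (Fin n → ℝ) →ₗ[ℝ] ℝ}
    (hl : ∀ F ∈ facets (crossSection (cone v) δ), IsFacetForm v δ F (l F)) {p : Fin n → ℝ}
    (hp : p ∈ crossSection (cone v) δ) :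
    bar (crossSection (cone v) δ) =
      ⋃ F ∈ facets (crossSection (cone v) δ), convexHull ℝ (insert p (bar F)) := by
  apply Set.Subset.antisymm
  · intro y hy
    rw [bar_crossSection_eq hpos] at hy
    obtain ⟨hyC, hy1⟩ := hy
    have hpW : p ∈ span ℝ (cone v) := subset_span hp.1
    have hyW : y ∈ span ℝ (cone v) := subset_span hyC
    -- Otherwise `-p` would satisfy all facet inequalities and lie in the cone, but `δ(-p) = -1`.
    have hnonempty : {F | F ∈ facets (crossSection (cone v) δ) ∧ 0 < l F p}.Nonempty := by
      by_contra! h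
      have hmem : -p ∈ cone v := by
        refine mem_cone_of_facetForms hpos hd hl (neg_mem hpW) fun F hF => ?_
        rw [map_neg, neg_nonneg]
        by_contra! h0
        have : F ∈ {F | F ∈ facets (crossSection (cone v) δ) ∧ 0 < l F p} := ⟨hF, h0⟩
        rw [h] at this
        exact this
      have hp0 : -p ≠ 0 := by
        intro h0
        have := hp.2
        rw [neg_eq_zero.1 h0, map_zero] at this
        exact zero_ne_one this
      have := hpos _ hmem hp0
      rw [map_neg, hp.2] at this
      linarith
    -- The minimal ratio is the largest `t` for which `y - t • p` is still in the cone, and `F` is a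
    -- facet reached there.
    obtain ⟨F, ⟨hF, hFp⟩, hmin⟩ := Set.exists_min_image _ (fun F => l F y / l F p)
      ((finite_facets hpos).subset (Set.sep_subset _ _)) hnonempty
    set t := l F y / l F p with ht
    have ht0 : 0 ≤ t := div_nonneg ((hl F hF).nonneg y hyC) hFp.le
    have hz : y - t • p ∈ cone v := by
      refine mem_cone_of_facetForms hpos hd hl (sub_mem hyW (smul_mem _ _ hpW)) fun G hG => ?_
      rw [map_sub, map_smul, smul_eq_mul, sub_nonneg]
      rcases ((hl G hG).nonneg p hp.1).eq_or_lt with h | h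
      · rw [← h, mul_zero]
        exact (hl G hG).nonneg y hyC
      · exact (le_div_iff₀ h).1 (hmin G ⟨hG, h⟩)
    have hlz : l F (y - t • p) = 0 := by
      rw [map_sub, map_smul, smul_eq_mul, ht, div_mul_cancel₀ _ hFp.ne', sub_self]
    have hδz : realForm δ (y - t • p) = realForm δ y - t := by
      rw [map_sub, map_smul, hp.2, smul_eq_mul, mul_one]
    refine Set.mem_biUnion hF ?_
    -- Since `δ(y - t • p) ≤ 1 - t`, division by `1 - t` leads into `bar F`. If `y = t • p`, then `t
    -- = 1` is possible and `y` lies between `0` and `p`.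
    by_cases hz0 : y - t • p = 0
    · rw [sub_eq_zero] at hz0
      have ht1 : t ≤ 1 := by
        rw [hz0, map_smul, hp.2, smul_eq_mul, mul_one] at hy1
        exact hy1
      rw [hz0]
      exact (convex_convexHull ℝ (insert p (bar F))).smul_mem_of_zero_mem
        (subset_convexHull ℝ _ (Or.inr (zero_mem_bar F))) (subset_convexHull ℝ _ (Or.inl rfl))
        ⟨ht0, ht1⟩
    · have hδpos := hpos _ hz hz0
      rw [hδz] at hδpos
      have ht1 : 0 < 1 - t := by linarith
      have hb : (1 - t)⁻¹ • (y - t • p) ∈ bar F := by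
        rw [(hl F hF).bar_eq hpos]
        refine ⟨⟨smul_mem_cone (inv_nonneg.2 ht1.le) hz, by rw [map_smul, hlz, smul_zero]⟩, ?_⟩
        rw [map_smul, hδz, smul_eq_mul, inv_mul_le_iff₀ ht1, mul_one]
        linarith
      have := convex_convexHull ℝ (insert p (bar F)) (subset_convexHull ℝ _ (Or.inl rfl))
        (subset_convexHull ℝ _ (Or.inr hb)) ht0 ht1.le (by ring)
      rwa [smul_inv_smul₀ ht1.ne', add_sub_cancel] at this
  · refine Set.iUnion₂_subset fun F hF => convexHull_min (Set.insert_subset (subset_bar _ hp) ?_)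
      (convex_convexHull ℝ _)
    exact convexHull_mono (Set.insert_subset_insert hF.2.1.subset)

/-- The normalized volume of a polytope as the sum of those of the pyramids over its facets. -/
theorem vol_bar_crossSection_eq_sum (hpos : ∀ x ∈ cone v, x ≠ 0 → 0 < realForm δ x)
    (hd : 1 ≤ dim (crossSection (cone v) δ)) {l : Set (Fin n → ℝ) → (Fin n → ℝ) →ₗ[ℝ] ℝ}
    (hl : ∀ F ∈ facets (crossSection (cone v) δ), IsFacetForm v δ F (l F)) {p : Fin n → ℝ}
    (hp : p ∈ crossSection (cone v) δ) :
    vol (bar (crossSection (cone v) δ)) =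
      ∑ F ∈ (finite_facets hpos).toFinset, l F p * vol (bar F) := by
  rw [vol_eq_relVol (zero_mem_bar _), span_bar, span_crossSection_eq hpos]
  have hset : {y : span ℝ (cone v) | (y : Fin n → ℝ) ∈ bar (crossSection (cone v) δ)} =
      ⋃ F ∈ (finite_facets hpos).toFinset,
        {y : span ℝ (cone v) | (y : Fin n → ℝ) ∈ convexHull ℝ (insert p (bar F))} := by
    ext y
    rw [bar_crossSection_eq_biUnion hpos hd hl hp]
    simp
  have hcomp : ∀ F ∈ (finite_facets hpos).toFinset,
      IsCompact {y : span ℝ (cone v) | (y : Fin n → ℝ) ∈ convexHull ℝ (insert p (bar F))} := by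
    intro F hF
    rw [Set.Finite.mem_toFinset] at hF
    refine (closed_of_finiteDimensional _).isClosedEmbedding_subtypeVal.isCompact_preimage ?_
    exact isCompact_convexHull_insert (convex_convexHull ℝ _) ((hl F hF).isCompact_bar hpos)
      ⟨0, zero_mem_bar F⟩
  rw [relVol, hset, measureReal_def, measure_biUnion_finset₀, ENNReal.toReal_sum,
    Finset.sum_div]
  · refine Finset.sum_congr rfl fun F hF => ?_
    rw [Set.Finite.mem_toFinset] at hF
    rw [← (hl F hF).relVol_pyramid hpos hF hp.1, relVol, measureReal_def, measureReal_def]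
  · exact fun F hF => (hcomp F hF).measure_lt_top.ne
  · intro F hF G hG hne
    rw [Set.Finite.coe_toFinset] at hF hG
    exact measure_inter_pyramids_eq_zero hpos (hl F hF) (hl G hG) hne hp.1 _
  · exact fun F hF => (hcomp F hF).measurableSet.nullMeasurableSet

end Facet

end

/-! ### The three claims for the linear hull of the cone. -/

section

variable {n m : ℕ} {v : Fin m → Fin n → ℤ} {δ : (Fin n → ℤ) →ₗ[ℤ] ℤ}

/-- The apex is `x` scaled into `P`; linearity of the facet forms pulls out the factor `1/δ(x)`. -/
theorem vol_bar_eq_finsum (hpos : ∀ x ∈ cone v, x ≠ 0 → 0 < realForm δ x)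
    (hd : 1 ≤ dim (crossSection (cone v) δ)) {x : Fin n → ℝ} (hx : x ∈ cone v) (hx0 : x ≠ 0) :
    vol (bar (crossSection (cone v) δ)) = 1 / realForm δ x *
      ∑ᶠ F ∈ facets (crossSection (cone v) δ), height (bar F) x * vol (bar F) := by
  have hex : ∀ F, ∃ l, F ∈ facets (crossSection (cone v) δ) → IsFacetForm v δ F l := fun F => by
    by_cases hF : F ∈ facets (crossSection (cone v) δ)
    · obtain ⟨l, hl⟩ := exists_isFacetForm hpos hd hF
      exact ⟨l, fun _ => hl⟩
    · exact ⟨0, fun h => absurd h hF⟩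
  choose l hl using hex
  rw [vol_bar_crossSection_eq_sum hpos hd hl (inv_smul_mem_crossSection hpos hx hx0),
    finsum_mem_eq_finite_toFinset_sum _ (finite_facets hpos), Finset.mul_sum]
  refine Finset.sum_congr rfl fun F hF => ?_
  rw [Set.Finite.mem_toFinset] at hF
  have h := hl F hF
  rw [height_bar_facet hpos hd hF h.primitive h.ker hx, abs_of_nonneg (h.nonneg x hx), map_smul,
    smul_eq_mul, one_div, mul_assoc]

theorem form_eq_sum_repr_mul {W : Submodule ℝ (Fin n → ℝ)} {ι : Type*} [Fintype ι]
    (u : Basis ι ℤ (lattice W)) (φ : (Fin n → ℤ) →ₗ[ℤ] ℤ) (z : lattice W) :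
    φ z = ∑ i, u.repr z i * φ (u i) := by
  have h := congrArg (φ ∘ₗ (lattice W).subtype) (u.sum_repr z)
  simp only [map_sum, map_smul, LinearMap.comp_apply, smul_eq_mul, subtype_apply] at h
  exact h.symm

/-- Dividing an integral form by the gcd of its values on a basis of the lattice makes it
primitive. -/
theorem isPrimitiveOn_div_gcd {W : Submodule ℝ (Fin n → ℝ)} {ι : Type*} [Fintype ι]
    (u : Basis ι ℤ (lattice W)) (φ : (Fin n → ℤ) →ₗ[ℤ] ℤ)
    (hg : (Finset.univ.gcd fun i => φ (u i : Fin n → ℤ)) ≠ 0) :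
    IsPrimitiveOn
      ((((Finset.univ.gcd fun i => φ (u i : Fin n → ℤ) : ℤ) : ℝ))⁻¹ • realForm φ) W := by
  set g := Finset.univ.gcd fun i => φ (u i : Fin n → ℤ) with hgdef
  have hgR : (g : ℝ) ≠ 0 := Int.cast_ne_zero.2 hg
  constructor
  · intro z hz
    have hdvd : g ∣ φ z := by
      rw [form_eq_sum_repr_mul u φ ⟨z, hz⟩]
      exact Finset.dvd_sum fun i _ => Dvd.dvd.mul_left (Finset.gcd_dvd (Finset.mem_univ i)) _
    obtain ⟨k, hk⟩ := hdvd
    refine ⟨k, ?_⟩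
    rw [LinearMap.smul_apply, realForm_intCast, hk, Int.cast_mul, smul_eq_mul,
      inv_mul_cancel_left₀ hgR]
  · obtain ⟨c, hc⟩ := Finset.gcd_eq_sum_mul Finset.univ fun i => φ (u i : Fin n → ℤ)
    refine ⟨∑ i, c i • (u i : Fin n → ℤ), sum_mem fun i _ => smul_mem _ _ (u i).2, ?_⟩
    have hφ : φ (∑ i, c i • (u i : Fin n → ℤ)) = g := by
      rw [hgdef, hc, map_sum]
      exact Finset.sum_congr rfl fun i _ => by rw [map_smul, smul_eq_mul, mul_comm]
    rw [LinearMap.smul_apply, realForm_intCast, hφ, smul_eq_mul, inv_mul_cancel₀ hgR]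

theorem height_eq_div_gcd (hpos : ∀ x ∈ cone v, x ≠ 0 → 0 < realForm δ x)
    (hd : 1 ≤ dim (crossSection (cone v) δ)) {F : Set (Fin n → ℝ)}
    (hF : F ∈ facets (crossSection (cone v) δ)) {φ : (Fin n → ℤ) →ₗ[ℤ] ℤ}
    (hφ : ∀ x ∈ bar (crossSection (cone v) δ), 0 ≤ realForm φ x)
    (hFφ : bar F = {x | x ∈ bar (crossSection (cone v) δ) ∧ realForm φ x = 0})
    {ι : Type*} [Fintype ι] (u : Basis ι ℤ (lattice (span ℝ (cone v)))) {x : Fin n → ℝ}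
    (hx : x ∈ cone v) :
    height (bar F) x =
      realForm φ x / ((Finset.univ.gcd fun i => φ (u i : Fin n → ℤ) : ℤ) : ℝ) := by
  have hfin := finrank_span_facet hpos hd hF
  have hφF : ∀ y ∈ span ℝ F, realForm φ y = 0 := form_eq_zero_on_span fun y hy => by
    have := subset_bar F hy
    rw [hFφ] at this
    exact this.2
  -- If `φ` vanished on the hull, `bar F` would equal `bar P`, against the dimension of a facet.
  obtain ⟨e, he, hφe⟩ : ∃ e ∈ span ℝ (cone v), realForm φ e ≠ 0 := by
    by_contra! h
    have hbar : bar F = bar (crossSection (cone v) δ) := by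
      rw [hFφ]
      refine Set.Subset.antisymm (fun y hy => hy.1) fun y hy => ⟨hy, h y ?_⟩
      rw [← span_crossSection_eq hpos, ← span_bar]
      exact subset_span hy
    rw [← span_bar, hbar, span_bar, span_crossSection_eq hpos] at hfin
    omega
  -- The hull is spanned by its lattice points, so a form that vanishes on a lattice basis vanishes
  -- on all of it.
  have hg : (Finset.univ.gcd fun i => φ (u i : Fin n → ℤ)) ≠ 0 := by
    intro h0
    rw [Finset.gcd_eq_zero_iff] at h0
    refine hφe ?_
    have : span ℝ (intCast n '' (lattice (span ℝ (cone v)) : Set (Fin n → ℤ))) ≤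
        LinearMap.ker (realForm φ) := by
      rw [span_le]
      rintro _ ⟨z, hz, rfl⟩
      change realForm φ (intCast n z) = 0
      rw [realForm_intCast, form_eq_sum_repr_mul u φ ⟨z, hz⟩,
        Finset.sum_eq_zero fun i hi => by rw [h0 i hi, mul_zero], Int.cast_zero]
    exact this (isRational_span_cone he)
  have hgR : ((Finset.univ.gcd fun i => φ (u i : Fin n → ℤ) : ℤ) : ℝ) ≠ 0 :=
    Int.cast_ne_zero.2 hg
  have hg0 : (0 : ℝ) ≤ ((Finset.univ.gcd fun i => φ (u i : Fin n → ℤ) : ℤ) : ℝ) :=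
    Int.cast_nonneg (Int.nonneg_of_normalize_eq_self Finset.normalize_gcd)
  rw [height_bar_facet hpos hd hF (isPrimitiveOn_div_gcd u φ hg) ?_ hx, LinearMap.smul_apply,
    smul_eq_mul, inv_mul_eq_div, abs_of_nonneg]
  · refine div_nonneg ?_ hg0
    by_cases hx0 : x = 0
    · rw [hx0, map_zero]
    have h1 := hφ _ (subset_bar _ (inv_smul_mem_crossSection hpos hx hx0))
    rw [map_smul, smul_eq_mul] at h1
    exact nonneg_of_mul_nonneg_right h1 (inv_pos.2 (hpos x hx hx0))
  · intro y hy
    rw [LinearMap.smul_apply, smul_eq_mul, mul_eq_zero, or_iff_right (inv_ne_zero hgR)]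
    exact ⟨mem_of_form_eq_zero (span_facet_le hF) hfin hφF he hφe hy, hφF y⟩

theorem existsUnique_matrix (u : Basis (Fin m) ℤ (lattice (span ℝ (cone v)))) :
    ∃! T : Matrix (Fin m) (Fin m) ℤ, ∀ i, v i = ∑ j, T i j • (u j : Fin n → ℤ) := by
  have hv : ∀ i, v i ∈ lattice (span ℝ (cone v)) := fun i => subset_span (intCast_mem_cone i)
  refine ⟨fun i j => u.repr ⟨v i, hv i⟩ j, fun i => ?_, fun T hT => ?_⟩
  · have := congrArg (lattice (span ℝ (cone v))).subtype (u.sum_repr ⟨v i, hv i⟩)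
    simp only [map_sum, map_smul, subtype_apply] at this
    exact this.symm
  · ext i j
    have : (⟨v i, hv i⟩ : lattice (span ℝ (cone v))) = ∑ j, T i j • u j := by
      apply Subtype.ext
      simpa using hT i
    rw [this, Basis.repr_sum_self]

/-- The vertices of `bar P` other than `0` are `vᵢ/δ(vᵢ)`; their coordinates in the basis `u` are
the rows of `T` divided by `δ(vᵢ)`. -/
theorem vol_bar_eq_det (hpos : ∀ x ∈ cone v, x ≠ 0 → 0 < realForm δ x)
    (u : Basis (Fin m) ℤ (lattice (span ℝ (cone v)))) {T : Matrix (Fin m) (Fin m) ℤ}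
    (hT : ∀ i, v i = ∑ j, T i j • (u j : Fin n → ℤ)) :
    vol (bar (crossSection (cone v) δ)) = 1 / (∏ i, (δ (v i) : ℝ)) * |(T.det : ℝ)| := by
  have hv : ∀ i, v i ∈ lattice (span ℝ (cone v)) := fun i => subset_span (intCast_mem_cone i)
  have hδ : ∀ i, 0 ≤ (δ (v i) : ℝ) := fun i => by
    rw [← realForm_intCast]
    by_cases h : intCast n (v i) = 0
    · rw [h, map_zero]
    · exact (hpos _ (intCast_mem_cone i) h).le
  let p : Fin m → span ℝ (cone v) := fun i => (δ (v i) : ℝ)⁻¹ • ⟨intCast n (v i), hv i⟩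
  -- The transpose appears because `toMatrix` writes coordinates in columns, and `T` has them in
  -- rows.
  have hp : ((realBasis isRational_span_cone u).toMatrix p) =
      (Matrix.of fun i j => (δ (v i) : ℝ)⁻¹ * T.map (Int.castRingHom ℝ) i j).transpose := by
    ext i j
    have h1 : (⟨v j, hv j⟩ : lattice (span ℝ (cone v))) = ∑ k, T j k • u k := by
      apply Subtype.ext
      simpa using hT j
    have h2 := realBasis_repr isRational_span_cone u ⟨v j, hv j⟩ i
    rw [h1, Basis.repr_sum_self, ← h1] at h2
    rw [Basis.toMatrix_apply, Matrix.transpose_apply, Matrix.of_apply, Matrix.map_apply]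
    simp only [p, map_smul, Finsupp.smul_apply, smul_eq_mul]
    rw [h2]
    rfl
  have hdet := (Int.castRingHom ℝ).map_det T
  rw [RingHom.mapMatrix_apply] at hdet
  have hvol := relVol_simplex isRational_span_cone u p
  rw [hp, Matrix.det_transpose,
    Matrix.det_mul_column (fun i => (δ (v i) : ℝ)⁻¹) (T.map (Int.castRingHom ℝ)), ← hdet, abs_mul, Finset.prod_inv_distrib,
    abs_of_nonneg (inv_nonneg.2 (Finset.prod_nonneg fun i _ => hδ i)), ← one_div] at hvol
  rw [vol_eq_relVol (zero_mem_bar _), span_bar, span_crossSection_eq hpos,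
    bar_crossSection_eq_convexHull hpos]
  exact hvol

end

end LatticeVolume

end

theorem proposition2p4 {n m d : ℕ} (v : Fin m → Fin n → ℤ) (δ : (Fin n → ℤ) →ₗ[ℤ] ℤ)
    (hδ : ∃ y, δ y = 1)
    (hpos : ∀ x ∈ LatticeVolume.cone v, x ≠ 0 → 0 < LatticeVolume.realForm δ x)
    (P : Set (Fin n → ℝ)) (hP : P = LatticeVolume.crossSection (LatticeVolume.cone v) δ)
    (hdim : d = LatticeVolume.dim P) (hd : 1 ≤ d) :
    -- (1), the sum being over a finite set
    ((LatticeVolume.facets P).Finite ∧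
      ∀ x ∈ LatticeVolume.cone v, x ≠ 0 →
        LatticeVolume.vol (LatticeVolume.bar P) =
          1 / LatticeVolume.realForm δ x *
            ∑ᶠ F ∈ LatticeVolume.facets P,
              LatticeVolume.height (LatticeVolume.bar F) x *
                LatticeVolume.vol (LatticeVolume.bar F)) ∧
    -- (2)
    (∀ F ∈ LatticeVolume.facets P, ∀ φ : (Fin n → ℤ) →ₗ[ℤ] ℤ,
      (∀ x ∈ LatticeVolume.bar P, 0 ≤ LatticeVolume.realForm φ x) →
      LatticeVolume.bar F =
        {x | x ∈ LatticeVolume.bar P ∧ LatticeVolume.realForm φ x = 0} →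
      ∀ u : Module.Basis (Fin (d + 1)) ℤ (LatticeVolume.barLattice P),
      ∀ x ∈ LatticeVolume.cone v,
        LatticeVolume.height (LatticeVolume.bar F) x =
          LatticeVolume.realForm φ x /
            ((Finset.univ.gcd fun i => φ (u i : Fin n → ℤ) : ℤ) : ℝ)) ∧
    -- (3), including that the integral matrix `T` exists and is unique
    (m = d + 1 → LinearIndependent ℝ (fun i => LatticeVolume.intCast n (v i)) →
      ∀ u : Module.Basis (Fin m) ℤ (LatticeVolume.barLattice P),
        (∃! T : Matrix (Fin m) (Fin m) ℤ,
          ∀ i, v i = ∑ j, T i j • (u j : Fin n → ℤ)) ∧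
        ∀ T : Matrix (Fin m) (Fin m) ℤ,
          (∀ i, v i = ∑ j, T i j • (u j : Fin n → ℤ)) →
          LatticeVolume.vol (LatticeVolume.bar P) =
            1 / (∏ i, (δ (v i) : ℝ)) * |(T.det : ℝ)|) := by

  subst hP hdim
  have hspan : (affineSpan ℝ (LatticeVolume.bar
      (LatticeVolume.crossSection (LatticeVolume.cone v) δ))).direction =
      Submodule.span ℝ (LatticeVolume.cone v) := by
    rw [LatticeVolume.affineSpan_bar, Submodule.toAffineSubspace_direction,
      LatticeVolume.span_crossSection_eq hpos]
  refine ⟨⟨LatticeVolume.finite_facets hpos, fun x hx hx0 =>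
    LatticeVolume.vol_bar_eq_finsum hpos hd hx hx0⟩, ?_, ?_⟩
  · unfold LatticeVolume.barLattice
    rw [hspan]
    exact fun F hF φ hφ hFφ u x hx => LatticeVolume.height_eq_div_gcd hpos hd hF hφ hFφ u hx
  · unfold LatticeVolume.barLattice
    rw [hspan]
    exact fun _ _ u => ⟨LatticeVolume.existsUnique_matrix u,
      fun T hT => LatticeVolume.vol_bar_eq_det hpos u hT⟩
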